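/- A finite directed graph $T$ is a \emph{single-rooted directed tree} (arborescence) if it has a vertex $r$ such that for each vertex $v$ there is exactly one directed path from $r$ to $v$. A sequence $(v_0,\dots,v_{k-1})$ of vertices of $T$ is a \emph{burning sequence} if $B_{k-1}=V(T)$, where $B_0=\{v_0\}$ and, for $1\le i<k$, $B_i$ consists of $v_i$, all vertices of $B_{i-1}$ and all out-neighbours of vertices of $B_{i-1}$. The \emph{burning number} $b(T)$ is the least length of a burning sequence of $T$. There is a polynomial-time $1.905$-approximation algorithm for the burning number of single-rooted directed trees: an algorithm that, given the adjacency matrix of a single-rooted directed tree $T$ with $n$ vertices, outputs a burning sequence of $T$ of length at most $1.905\cdot b(T)$, after a number of steps bounded by a polynomial in $n$. (Steps are counted on the unit-cost random access machine with addition and truncated subtraction, which is polynomially equivalent to Turing machines.) -/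

import Mathlib

/-! ### Burning a directed graph -/

/-- One round of burning on the digraph `G`: every vertex of the set `S` of burnt vertices burns
its out-neighbours, and the vertex `v` is selected as a new source of fire. -/
def Digraph.burnStep {V : Type*} (G : Digraph V) (S : Set V) (v : V) : Set V :=
  S ∪ {w | ∃ u ∈ S, G.Adj u w} ∪ {v}

/-- The set of burnt vertices after the rounds in which the vertices of the list were selected,
in this order, as sources of fire (before the first round nothing is burnt). -/
def Digraph.burnt {V : Type*} (G : Digraph V) (l : List V) : Set V :=
  l.foldl G.burnStep ∅

/-- A list of vertices is a burning sequence of `G` if every vertex is burnt at the end of its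
last round. -/
def Digraph.IsBurningSequence {V : Type*} (G : Digraph V) (l : List V) : Prop :=
  G.burnt l = Set.univ

/-- The burning number of `G`: the least length of a burning sequence of `G`. -/
noncomputable def Digraph.burningNumber {V : Type*} (G : Digraph V) : ℕ :=
  sInf {k | ∃ l : List V, l.length = k ∧ G.IsBurningSequence l}

/-- A digraph as a quiver: there is exactly one arrow from `u` to `v` if `uv` is an edge, and none
otherwise. -/
@[reducible] def Digraph.toQuiver {V : Type*} (G : Digraph V) : Quiver.{0} V where
  Hom u v := PLift (G.Adj u v)

/-- `G` is a single-rooted directed tree (an arborescence): for some vertex, the root, there is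
exactly one directed path from the root to each vertex. -/
def Digraph.IsArborescence {V : Type*} (G : Digraph V) : Prop :=
  Nonempty (@Quiver.Arborescence V G.toQuiver)

/-! ### A random access machine

The programs are structured programs for the unit-cost random access machine with addition and
truncated subtraction (and without multiplication, so that the numbers written in `t` steps have
`O(t + log n)` bits, and polynomial time means the same as on Turing machines). The memory consists
of registers and of arrays, all of whose entries are natural numbers. A program has a fixed finite
text and so names only finitely many registers and arrays, whereas the position in an array is
computed while the program runs. -/

namespace RAM

/-- A memory content: the registers, and the arrays with their entries. -/
structure State where
  /-- The number in the register `x`. -/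
  reg : ℕ → ℕ
  /-- The number in the array `a` at the position `i`. -/
  arr : ℕ → ℕ → ℕ

/-- Arithmetical expressions. -/
inductive Expr where
  | const (c : ℕ)
  | reg (x : ℕ)
  | read (a : ℕ) (i : Expr)
  | add (e f : Expr)
  | sub (e f : Expr)

/-- The value of an expression (the subtraction is truncated). -/
def Expr.eval (s : State) : Expr → ℕ
  | .const c => c
  | .reg x => s.reg x
  | .read a i => s.arr a (i.eval s)
  | .add e f => e.eval s + f.eval s
  | .sub e f => e.eval s - f.eval s

/-- The number of steps in the evaluation of an expression: one for each operation, register access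
and constant in it. -/
def Expr.cost : Expr → ℕ
  | .const _ => 1
  | .reg _ => 1
  | .read _ i => i.cost + 1
  | .add e f => e.cost + f.cost + 1
  | .sub e f => e.cost + f.cost + 1

/-- Programs. `assign x e` puts the value of `e` into the register `x`; `store a i e` puts it into
the array `a` at the position given by the value of `i`; `ite e f p q` runs `p` if the value of `e`
is less than that of `f`, and `q` otherwise; `loop e f p` repeats `p` as long as the value of `e` is
less than that of `f`. -/
inductive Prog where
  | skip
  | assign (x : ℕ) (e : Expr)
  | store (a : ℕ) (i e : Expr)
  | seq (p q : Prog)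
  | ite (e f : Expr) (p q : Prog)
  | loop (e f : Expr) (p : Prog)

/-- The memory after writing `v` into the register `x`. -/
def State.setReg (s : State) (x v : ℕ) : State :=
  { s with reg := Function.update s.reg x v }

/-- The memory after writing `v` into the array `a` at the position `i`. -/
def State.setArr (s : State) (a i v : ℕ) : State :=
  { s with arr := Function.update s.arr a (Function.update (s.arr a) i v) }

/-- `Run p s t s'`: started on the memory content `s`, the program `p` halts after exactly `t`
steps with the memory content `s'`. -/
inductive Run : Prog → State → ℕ → State → Prop where
  | skip (s : State) : Run .skip s 1 s
  | assign (x : ℕ) (e : Expr) (s : State) :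
      Run (.assign x e) s (e.cost + 1) (s.setReg x (e.eval s))
  | store (a : ℕ) (i e : Expr) (s : State) :
      Run (.store a i e) s (i.cost + e.cost + 1) (s.setArr a (i.eval s) (e.eval s))
  | seq {p q : Prog} {s s' s'' : State} {t t' : ℕ} (hp : Run p s t s') (hq : Run q s' t' s'') :
      Run (.seq p q) s (t + t') s''
  | ite_true {e f : Expr} {p q : Prog} {s s' : State} {t : ℕ} (h : e.eval s < f.eval s)
      (hp : Run p s t s') : Run (.ite e f p q) s (e.cost + f.cost + 1 + t) s'
  | ite_false {e f : Expr} {p q : Prog} {s s' : State} {t : ℕ} (h : ¬ e.eval s < f.eval s)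
      (hq : Run q s t s') : Run (.ite e f p q) s (e.cost + f.cost + 1 + t) s'
  | loop_true {e f : Expr} {p : Prog} {s s' s'' : State} {t t' : ℕ} (h : e.eval s < f.eval s)
      (hp : Run p s t s') (hl : Run (.loop e f p) s' t' s'') :
      Run (.loop e f p) s (e.cost + f.cost + 1 + t + t') s''
  | loop_false {e f : Expr} {p : Prog} {s : State} (h : ¬ e.eval s < f.eval s) :
      Run (.loop e f p) s (e.cost + f.cost + 1) s

open Classical in
/-- The input memory for a digraph on the vertices `0, …, n - 1`: register `0` holds `n`, array `0`
holds the adjacency matrix, row after row, and everything else is `0`. -/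
noncomputable def digraphInput {n : ℕ} (G : Digraph (Fin n)) : State where
  reg x := if x = 0 then n else 0
  arr a k := if a = 0 ∧ ∃ i j : Fin n, k = i * n + j ∧ G.Adj i j then 1 else 0

/-- The memory content `s` has the list `l` of vertices as its output: register `0` holds the length
of `l`, and array `0` starts with the members of `l`, in this order. -/
def State.HasOutput {n : ℕ} (s : State) (l : List (Fin n)) : Prop :=
  s.reg 0 = l.length ∧ ∀ i : Fin l.length, s.arr 0 i = (l.get i : ℕ)

end RAM

/-!
The algorithm has approximation ratio `11 / 6`.

Guess the burning number `b` and put `a = b / 2`. In a burning sequence of length `b`, the fires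
have the radii `0, …, b - 1`. Round the radii less than `a` up to `a - 1` (small fires) and the
others up to `b - 1` (large fires). If a small fire costs `2` and a large one `3`, an arborescence
with burning number `b` is thus burnt by fires of total cost at most `3 * b - a`
(`TwoRadii.minCost_root_add_le`).

The cheapest way of burning an arborescence by fires of these two radii, without regard to their
number, is found by dynamic programming. If the fire at the vertex `v` spreads over `j` further
edges, the least cost `T v j` below `v` is a sum over the children of `v`, since the fires never
spread from one subtree to another (`TwoRadii.IsCostTable`). The optimal decisions are then read off
from the root downwards (`TwoRadii.IsLevelFunction`). That they cost as little as the table says,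
and that nothing is cheaper, follows by summing the local relations over all vertices: the sums
telescope along the edges (`TwoRadii.IsCostTable.sum_add`).

The algorithm takes the first `b` for which `x` large and `y` small fires suffice such that
`3 * x + 2 * y ≤ 3 * b - a`; this `b` is at most the burning number. Put `k = 11 * b / 6`. The bound
gives `x + b - 1 ≤ k` and `x + y + a - 1 ≤ k`, so that in a list of length `k` beginning with the
large fires, followed by the small ones, each fire is lit early enough to reach its radius. The two
prices balance the extreme cases, in which all fires are large (`k` close to `11 / 6 * b`) or all
are small (`k` close to `7 / 4 * b`).

On the random access machine, no ordering of the vertices is needed: `n` passes over all vertices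
make the cost table correct from the leaves upwards, and `n` further passes make the levels correct
from the root downwards. The loops of the program are repeated at most `2 * n` times each, which
yields a polynomial bound for the running time (`RAM.Prog.timeBound`).
-/

/-! ### Burning sequences and arborescences -/

namespace Digraph

variable {V : Type*} (G : Digraph V)

theorem burnt_concat (l : List V) (v : V) : G.burnt (l ++ [v]) = G.burnStep (G.burnt l) v := by
  simp [burnt]

theorem burnt_subset_burnt_append (l l' : List V) : G.burnt l ⊆ G.burnt (l ++ l') := by
  induction l' using List.reverseRecOn with
  | nil => simp
  | append_singleton l' v ih =>
    rw [← List.append_assoc, burnt_concat]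
    exact fun x hx => Or.inl (Or.inl (ih hx))

theorem burnt_take_mono (l : List V) {i j : ℕ} (h : i ≤ j) :
    G.burnt (l.take i) ⊆ G.burnt (l.take j) := by
  have : l.take j = l.take i ++ (l.take j).drop i := by
    conv_lhs => rw [← List.take_append_drop i (l.take j)]
    rw [List.take_take, min_eq_left h]
  rw [this]
  exact G.burnt_subset_burnt_append _ _

theorem burnt_take_succ (l : List V) {i : ℕ} (hi : i < l.length) :
    G.burnt (l.take (i + 1)) = G.burnStep (G.burnt (l.take i)) l[i] := by
  rw [← burnt_concat, List.take_append_getElem]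

theorem getElem_mem_burnt_take (l : List V) {i j : ℕ} (hi : i < l.length) (hj : i < j) :
    l[i] ∈ G.burnt (l.take j) := by
  refine G.burnt_take_mono l hj ?_
  rw [burnt_take_succ G l hi]
  exact Or.inr rfl

theorem isBurningSequence_of_forall_mem {l : List V} (h : ∀ v, v ∈ l) :
    G.IsBurningSequence l := by
  refine Set.eq_univ_of_forall fun v => ?_
  obtain ⟨i, hi, rfl⟩ := List.getElem_of_mem (h v)
  simpa using G.getElem_mem_burnt_take l hi hi

theorem exists_isBurningSequence_length_eq_burningNumber [Fintype V] :
    ∃ l : List V, l.length = G.burningNumber ∧ G.IsBurningSequence l :=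
  Nat.sInf_mem (s := {k | ∃ l : List V, l.length = k ∧ G.IsBurningSequence l})
    ⟨_, Finset.univ.toList, rfl, G.isBurningSequence_of_forall_mem (by simp)⟩

theorem burningNumber_le_card [Fintype V] : G.burningNumber ≤ Fintype.card V :=
  Nat.sInf_le ⟨Finset.univ.toList, by simp, G.isBurningSequence_of_forall_mem (by simp)⟩

theorem burningNumber_pos [Fintype V] [Nonempty V] : 0 < G.burningNumber := by
  obtain ⟨l, hl, h⟩ := G.exists_isBurningSequence_length_eq_burningNumber
  rw [← hl, List.length_pos_iff]
  rintro rfl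
  simp [IsBurningSequence, burnt, Set.empty_ne_univ] at h

/-- The properties of an arborescence on which the algorithm relies: `r` is the root and `d v` is
the depth of the vertex `v`. -/
structure IsRooted {n : ℕ} (G : Digraph (Fin n)) (r : Fin n) (d : Fin n → ℕ) : Prop where
  depth_succ {u v : Fin n} : G.Adj u v → d v = d u + 1
  depth_lt (v : Fin n) : d v < n
  not_adj_root (u : Fin n) : ¬ G.Adj u r
  existsUnique_parent (v : Fin n) : v ≠ r → ∃! u, G.Adj u v

theorem IsArborescence.exists_isRooted {n : ℕ} {G : Digraph (Fin n)} (h : G.IsArborescence) :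
    ∃ r d, G.IsRooted r d := by
  obtain ⟨A⟩ := h
  let Q := G.toQuiver
  let r : Fin n := Quiver.root (Fin n)
  let P (v : Fin n) : Quiver.Path r v := default
  have hP {v : Fin n} (p : Quiver.Path r v) : p = P v := Subsingleton.elim _ _
  have hcons {u v : Fin n} (e : G.Adj u v) : (P u).cons (⟨e⟩ : u ⟶ v) = P v := hP _
  have hsucc {u v : Fin n} (e : G.Adj u v) : (P v).length = (P u).length + 1 := by
    rw [← hcons e, Quiver.Path.length_cons]
  have hroot : (P r).length = 0 := by rw [← hP .nil, Quiver.Path.length_nil]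
  -- Every depth up to that of `v` is the depth of a vertex of the path from the root to `v`.
  have hlt (v : Fin n) (p : Quiver.Path r v) (j : ℕ) (hj : j ≤ p.length) :
      ∃ u, (P u).length = j := by
    induction p with
    | nil => exact ⟨r, by rw [hroot]; exact (Nat.le_zero.1 hj).symm⟩
    | cons p e ih =>
      rename_i w x
      rcases Nat.lt_or_ge j (p.length + 1) with hj' | hj'
      · exact ih (by omega)
      · refine ⟨x, ?_⟩
        rw [← hP (p.cons e)]
        exact le_antisymm hj' (by simpa using hj)
  refine ⟨r, fun v => (P v).length, fun e => hsucc e, fun v => ?_, fun u e => ?_, fun v hv => ?_⟩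
  · choose f hf using fun j : Fin ((P v).length + 1) => hlt v (P v) j (by omega)
    have hinj : Function.Injective f := fun i j hij => by
      have := hf i
      rw [hij, hf j] at this
      exact Fin.ext this.symm
    simpa using Fintype.card_le_of_injective f hinj
  · have := hsucc e
    omega
  · obtain ⟨u, e⟩ : ∃ u, G.Adj u v := by
      rcases hp : P v with _ | ⟨p, e⟩
      · exact absurd rfl hv
      · exact ⟨_, e.down⟩
    refine ⟨u, e, fun u' e' => ?_⟩
    have := (hcons e').trans (hcons e).symm
    exact Quiver.Path.obj_eq_of_cons_eq_cons this

end Digraph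

/-! ### The weighted covering problem with two radii

Fires of two kinds are available: large ones, of radius `b - 1` and cost `3`, and small ones, of
radius `a - 1` and cost `2`. For `a = 0`, the truncated subtraction makes the radius of the small
ones `0`, which does no harm: the cost bound does not depend on them, and they fit into the
output. -/

namespace TwoRadii

/-- The least cost at a vertex `v` at which a new fire is lit, including the cost below `v`: here
`f j` is the least cost of burning all the proper descendants of `v` if the fire at `v` spreads over
`j` further edges. -/
def newCost (a b : ℕ) (f : ℕ → ℕ) : ℕ :=
  if f (b - 1) < f (a - 1) then 3 + f (b - 1) else 2 + f (a - 1)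

/-- No new fire is lit at a vertex: the fire that arrives there burns it and `h - 1` further levels
(for `h = 0`, no fire arrives), and relying on this fire is as cheap as lighting a new one. -/
def Passive (a b : ℕ) (f : ℕ → ℕ) (h : ℕ) : Prop :=
  0 < h ∧ f (h - 1) < newCost a b f + 1

instance (a b : ℕ) (f : ℕ → ℕ) (h : ℕ) : Decidable (Passive a b f h) :=
  inferInstanceAs (Decidable (_ ∧ _))

/-- The least cost of burning a vertex and its descendants, if a fire burning `h` levels arrives. -/
def minCost (a b : ℕ) (f : ℕ → ℕ) (h : ℕ) : ℕ :=
  if Passive a b f h then f (h - 1) else newCost a b f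

/-- The cost of the fire that is lit at a vertex by an optimal decision. -/
def pay (a b : ℕ) (f : ℕ → ℕ) (h : ℕ) : ℕ :=
  if Passive a b f h then 0 else if f (b - 1) < f (a - 1) then 3 else 2

/-- The number of further edges over which the fire at a vertex spreads, after an optimal
decision. -/
def out (a b : ℕ) (f : ℕ → ℕ) (h : ℕ) : ℕ :=
  if Passive a b f h then h - 1 else if f (b - 1) < f (a - 1) then b - 1 else a - 1

variable {a b : ℕ} {f : ℕ → ℕ} {h : ℕ}

theorem minCost_eq_pay_add : minCost a b f h = pay a b f h + f (out a b f h) := by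
  unfold minCost pay out newCost
  split_ifs <;> simp

theorem minCost_le_newCost : minCost a b f h ≤ newCost a b f := by
  unfold minCost
  split_ifs with hp
  · exact Nat.lt_succ_iff.1 hp.2
  · exact le_rfl

theorem minCost_le_large : minCost a b f h ≤ 3 + f (b - 1) := by
  refine minCost_le_newCost.trans ?_
  unfold newCost
  split_ifs <;> omega

theorem minCost_le_small : minCost a b f h ≤ 2 + f (a - 1) := by
  refine minCost_le_newCost.trans ?_
  unfold newCost
  split_ifs <;> omega

theorem minCost_le_passive (hh : 0 < h) : minCost a b f h ≤ f (h - 1) := by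
  unfold minCost
  split_ifs with hp
  · exact le_rfl
  · simp only [Passive, not_and, not_lt] at hp
    have := hp hh
    omega

theorem minCost_antitone {h' : ℕ} (hf : ∀ i j, i ≤ j → j < b → f j ≤ f i) (hh : h ≤ h')
    (hb : h' ≤ b) : minCost a b f h' ≤ minCost a b f h := by
  by_cases hp : Passive a b f h
  · conv_rhs => rw [minCost, if_pos hp]
    have := hp.1
    exact (minCost_le_passive (by omega)).trans (hf _ _ (by omega) (by omega))
  · conv_rhs => rw [minCost, if_neg hp]
    exact minCost_le_newCost

theorem out_lt (hb : 0 < b) (hab : a ≤ b) (hh : h < b) : out a b f h < b := by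
  unfold out
  split_ifs <;> omega

/-- The total cost of the fires of radii `0, …, b - 1`, if those of radius less than `a` are
counted as small. -/
theorem sum_cost_add (hab : a ≤ b) :
    ∑ i ∈ Finset.range b, (if b - (i + 1) < a then 2 else 3) + a = 3 * b := by
  have key (c : ℕ) : ∑ i ∈ Finset.range c, (if i < a then 2 else 3) + min a c = 3 * c := by
    induction c with
    | zero => simp
    | succ c ih =>
      rw [Finset.sum_range_succ]
      split_ifs <;> omega
  have h1 := Finset.sum_range_reflect (fun i => if i < a then 2 else 3) b
  have h2 := key b
  rw [min_eq_left hab] at h2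
  rw [← h2, ← h1]
  simp only [Nat.sub_sub, Nat.add_comm 1]

section Tree

open Finset Digraph

variable {n : ℕ} {G : Digraph (Fin n)} {r : Fin n} {d : Fin n → ℕ}

open Classical in
/-- Every vertex except the root is a child of exactly one vertex. -/
theorem sum_sum_children_add (hG : G.IsRooted r d) (φ : Fin n → ℕ) :
    ∑ v, ∑ w, (if G.Adj v w then φ w else 0) + φ r = ∑ w, φ w := by
  rw [sum_comm, ← sum_erase_add _ _ (mem_univ r), ← sum_erase_add (s := univ) φ (mem_univ r)]
  have h0 : ∑ v, (if G.Adj v r then φ r else 0) = 0 :=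
    Finset.sum_eq_zero fun v _ => if_neg (hG.not_adj_root v)
  rw [h0, add_zero]
  congr 1
  refine sum_congr rfl fun w hw => ?_
  obtain ⟨u, hu, huniq⟩ := hG.existsUnique_parent w (ne_of_mem_erase hw)
  rw [sum_eq_single u, if_pos hu]
  · exact fun v _ hv => if_neg fun e => hv (huniq v e)
  · simp

open Classical in
/-- `T v j` is the least cost of burning all the proper descendants of `v`, if the fire at `v`
spreads over `j < b` further edges: the sum of the least costs for the children of `v`. -/
def IsCostTable (G : Digraph (Fin n)) (a b : ℕ) (T : Fin n → ℕ → ℕ) : Prop :=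
  ∀ v, ∀ j < b, T v j = ∑ w, if G.Adj v w then minCost a b (T w) j else 0

variable {T : Fin n → ℕ → ℕ} {F : Fin n → ℕ}

/-- A fire that spreads further costs no more below `v`. -/
theorem IsCostTable.antitone (hT : IsCostTable G a b T) (hG : G.IsRooted r d) (v : Fin n) :
    ∀ i j, i ≤ j → j < b → T v j ≤ T v i := by
  induction hk : n - d v using Nat.strong_induction_on generalizing v with
  | _ k ih =>
    intro i j hij hj
    rw [hT v j hj, hT v i (by omega)]
    refine sum_le_sum fun w _ => ?_
    split_ifs with e
    · have h1 := hG.depth_succ e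
      have h2 := hG.depth_lt w
      exact minCost_antitone (ih _ (by omega) w rfl) hij hj.le
    · exact le_rfl

/-- If the fire at each vertex `v` spreads over `o v` further edges, and a fire burning `I w` levels
arrives at each vertex `w`, then the costs telescope along the edges of the tree. -/
theorem IsCostTable.sum_add (hT : IsCostTable G a b T) (hG : G.IsRooted r d) {o I : Fin n → ℕ}
    (ho : ∀ v, o v < b) (hI : ∀ v w, G.Adj v w → I w = o v) :
    ∑ v, T v (o v) + minCost a b (T r) (I r) = ∑ v, minCost a b (T v) (I v) := by
  rw [← sum_sum_children_add hG fun v => minCost a b (T v) (I v)]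
  congr 1
  refine sum_congr rfl fun v _ => ?_
  rw [hT v _ (ho v)]
  refine sum_congr rfl fun w _ => ?_
  split_ifs with e
  · rw [hI v w e]
  · rfl

/-- `F w` is the number of levels burnt by the fire that arrives at `w`, if optimal decisions are
made everywhere. -/
def IsLevelFunction (G : Digraph (Fin n)) (a b : ℕ) (T : Fin n → ℕ → ℕ) (F : Fin n → ℕ) : Prop :=
  ∀ v w, G.Adj v w → F w = out a b (T v) (F v)

theorem IsLevelFunction.lt (hF : IsLevelFunction G a b T F) (hG : G.IsRooted r d) (hr : F r = 0)
    (hb : 0 < b) (hab : a ≤ b) (v : Fin n) : F v < b := by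
  induction hk : d v using Nat.strong_induction_on generalizing v with
  | _ k ih =>
    by_cases hv : v = r
    · rwa [hv, hr]
    · obtain ⟨u, hu, -⟩ := hG.existsUnique_parent v hv
      rw [hF u v hu]
      have := hG.depth_succ hu
      exact out_lt hb hab (ih _ (by omega) u rfl)

/-- The fires lit by optimal decisions cost as much as the table says. -/
theorem sum_pay_eq (hT : IsCostTable G a b T) (hF : IsLevelFunction G a b T F)
    (hG : G.IsRooted r d) (hr : F r = 0) (hb : 0 < b) (hab : a ≤ b) :
    ∑ v, pay a b (T v) (F v) = minCost a b (T r) 0 := by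
  have h := hT.sum_add hG (fun v => out_lt hb hab (hF.lt hG hr hb hab v)) hF
  rw [← sum_congr rfl fun v _ => (minCost_eq_pay_add (f := T v) (h := F v)).symm,
    sum_add_distrib, hr] at h
  omega

/-- A burning sequence of length `b` gives a solution of the weighted covering problem: the fires
of radius less than `a` are replaced by small ones, and the others by large ones. -/
theorem minCost_root_add_le (hT : IsCostTable G a b T) (hG : G.IsRooted r d) (hab : a ≤ b)
    {l : List (Fin n)} (hl : l.length = b) (hburn : G.IsBurningSequence l) :
    minCost a b (T r) 0 + a ≤ 3 * b := by
  classical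
  have hex (v : Fin n) : ∃ m, v ∈ G.burnt (l.take m) :=
    ⟨l.length, by rw [List.take_length, hburn]; trivial⟩
  -- The vertex `v` is burnt in the `m v`-th round, so that its fire spreads over `b - m v` edges.
  let m (v : Fin n) : ℕ := Nat.find (hex v)
  have hm (v) : v ∈ G.burnt (l.take (m v)) := Nat.find_spec (hex v)
  have hm_min {v k} (h : v ∈ G.burnt (l.take k)) : m v ≤ k := Nat.find_min' (hex v) h
  have hm_pos (v) : 0 < m v := by
    rw [Nat.pos_iff_ne_zero]
    intro h0
    have := hm v
    rw [h0] at this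
    simp [burnt] at this
  have hm_le (v) : m v ≤ b := by
    refine hm_min ?_
    rw [← hl, List.take_length, hburn]
    trivial
  choose! par hpar hparu using fun v hv => (hG.existsUnique_parent v hv)
  let o (v : Fin n) : ℕ := b - m v
  let I (v : Fin n) : ℕ := if v = r then 0 else o (par v)
  let c (v : Fin n) : ℕ :=
    if l[m v - 1]? = some v then (if b - (m v - 1 + 1) < a then 2 else 3) else 0
  have ho (v) : o v < b := by
    have := hm_pos v
    have := hm_le v
    simp only [o]
    omega
  have hI (v w) (e : G.Adj v w) : I w = o v := by
    have hw : w ≠ r := fun h => hG.not_adj_root v (h ▸ e)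
    simp only [I, if_neg hw]
    rw [hparu w hw v e]
  have hstep (v) : minCost a b (T v) (I v) ≤ c v + T v (o v) := by
    have hanti := hT.antitone hG v
    have h1 := hm_pos v
    have h2 := hm_le v
    by_cases hs : l[m v - 1]? = some v
    · simp only [c, if_pos hs]
      split_ifs with hlt
      · exact minCost_le_small.trans
          (Nat.add_le_add_left (hanti _ _ (by simp only [o]; omega) (by omega)) _)
      · exact minCost_le_large.trans
          (Nat.add_le_add_left (hanti _ _ (by simp only [o]; omega) (by omega)) _)
    · -- The vertex `v` is set on fire by its parent.
      have hv := hm v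
      obtain ⟨i, hi⟩ : ∃ i, m v = i + 1 := ⟨m v - 1, by omega⟩
      have hil : i < l.length := by omega
      rw [hi, burnt_take_succ G l hil] at hv
      rw [hi, Nat.add_sub_cancel, List.getElem?_eq_getElem hil] at hs
      rcases hv with (hv | ⟨u, hu, e⟩) | hv
      · have := hm_min hv
        omega
      · have h3 := hm_min hu
        have hIv := hI u v e
        have h4 : I v - 1 < b := by have := ho u; omega
        refine (minCost_le_passive ?_).trans
          ((hanti (o v) _ ?_ h4).trans (Nat.le_add_left _ _))
        · simp only [hIv, o]; omega
        · simp only [hIv, o]; omega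
      · exact absurd (congrArg some (Set.mem_singleton_iff.1 hv).symm) hs
  -- Each round has only one source of fire.
  have hc : ∑ v, c v ≤ ∑ i ∈ range b, (if b - (i + 1) < a then 2 else 3) := by
    calc ∑ v, c v ≤ ∑ v, ∑ i ∈ range b,
          (if l[i]? = some v then (if b - (i + 1) < a then 2 else 3) else 0) := by
          refine sum_le_sum fun v _ => ?_
          have h1 := hm_pos v
          have h2 := hm_le v
          exact single_le_sum (f := fun i =>
            if l[i]? = some v then (if b - (i + 1) < a then 2 else 3) else 0)
            (fun _ _ => Nat.zero_le _) (mem_range.2 (by omega : m v - 1 < b))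
      _ ≤ _ := by
          rw [sum_comm]
          refine sum_le_sum fun i hi => ?_
          have hil : i < l.length := by rw [hl]; exact mem_range.1 hi
          simp [List.getElem?_eq_getElem hil]
  have h1 := hT.sum_add hG ho hI
  have h2 := sum_le_sum fun v (_ : v ∈ univ) => hstep v
  rw [sum_add_distrib] at h2
  have h3 := sum_cost_add hab
  have h4 : I r = 0 := if_pos rfl
  rw [h4] at h1
  omega

/-- A list of length `k` burns the tree if each fire that the optimal decisions light is lit early
enough to reach its radius. -/
theorem isBurningSequence_of_forall_pay (hF : IsLevelFunction G a b T F) (hG : G.IsRooted r d)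
    (hr : F r = 0) {l : List (Fin n)}
    (hl : ∀ v, pay a b (T v) (F v) ≠ 0 →
      ∃ i, l[i]? = some v ∧ i + 1 + out a b (T v) (F v) ≤ l.length) :
    G.IsBurningSequence l := by
  have key (v : Fin n) : out a b (T v) (F v) < l.length ∧
      v ∈ G.burnt (l.take (l.length - out a b (T v) (F v))) := by
    induction hk : d v using Nat.strong_induction_on generalizing v with
    | _ k ih =>
      by_cases hp : Passive a b (T v) (F v)
      · have hpos := hp.1
        have hv : v ≠ r := by
          rintro rfl
          omega
        obtain ⟨u, hu, -⟩ := hG.existsUnique_parent v hv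
        have hd := hG.depth_succ hu
        obtain ⟨h1, h2⟩ := ih _ (by omega) u rfl
        have hout : out a b (T v) (F v) = F v - 1 := if_pos hp
        rw [← hF u v hu] at h1 h2
        refine ⟨by omega, ?_⟩
        have hlt : l.length - F v < l.length := by omega
        have heq : l.length - out a b (T v) (F v) = l.length - F v + 1 := by omega
        rw [heq, burnt_take_succ G l hlt]
        exact Or.inl (Or.inr ⟨u, h2, hu⟩)
      · obtain ⟨i, hi, hle⟩ := hl v (by
          rw [pay, if_neg hp]
          split_ifs <;> simp)
        obtain ⟨hil, rfl⟩ := List.getElem?_eq_some_iff.1 hi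
        exact ⟨by omega, G.getElem_mem_burnt_take l hil (by omega)⟩
  refine Set.eq_univ_of_forall fun v => ?_
  have := G.burnt_take_mono l (Nat.sub_le _ _) (key v).2
  rwa [List.take_length] at this

end Tree

end TwoRadii

/-! ### Reasoning about programs of the random access machine -/

namespace RAM

@[simp] theorem State.reg_setReg (s : State) (x v y : ℕ) :
    (s.setReg x v).reg y = if y = x then v else s.reg y := by
  simp [State.setReg, Function.update_apply]

@[simp] theorem State.arr_setReg (s : State) (x v : ℕ) : (s.setReg x v).arr = s.arr := rfl

@[simp] theorem State.reg_setArr (s : State) (c i v : ℕ) : (s.setArr c i v).reg = s.reg := rfl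

theorem State.arr_setArr (s : State) (c i v c' : ℕ) :
    (s.setArr c i v).arr c' = if c' = c then Function.update (s.arr c) i v else s.arr c' := by
  simp only [State.setArr, Function.update_apply]

@[simp] theorem State.arr_setArr_self (s : State) (c i v : ℕ) :
    (s.setArr c i v).arr c = Function.update (s.arr c) i v := by
  simp [State.arr_setArr]

namespace Prog

/-- Whether the program contains an assignment to the register `x`. -/
def writesReg : Prog → ℕ → Bool
  | skip, _ => false
  | assign y _, x => x == y
  | store _ _ _, _ => false
  | seq p q, x => p.writesReg x || q.writesReg x
  | ite _ _ p q, x => p.writesReg x || q.writesReg x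
  | loop _ _ p, x => p.writesReg x

/-- Whether the program contains a store into the array `c`. -/
def writesArr : Prog → ℕ → Bool
  | skip, _ => false
  | assign _ _, _ => false
  | store c' _ _, c => c == c'
  | seq p q, c => p.writesArr c || q.writesArr c
  | ite _ _ p q, c => p.writesArr c || q.writesArr c
  | loop _ _ p, c => p.writesArr c

/-- A bound for the number of steps of the program, provided that each of its loops is repeated at
most `m` times whenever it is reached. -/
def timeBound (m : ℕ) : Prog → ℕ
  | skip => 1
  | assign _ e => e.cost + 1
  | store _ i e => i.cost + e.cost + 1
  | seq p q => p.timeBound m + q.timeBound m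
  | ite e f p q => e.cost + f.cost + 1 + (p.timeBound m + q.timeBound m)
  | loop e f p => (m + 1) * (e.cost + f.cost + 1 + p.timeBound m)

theorem exists_polynomial_timeBound (p : Prog) :
    ∃ q : Polynomial ℕ, ∀ m, p.timeBound m = q.eval m := by
  open Polynomial in
  induction p with
  | skip => exact ⟨1, fun m => by simp [timeBound]⟩
  | assign x e => exact ⟨C (e.cost + 1), fun m => by rw [eval_C, timeBound]⟩
  | store c i e => exact ⟨C (i.cost + e.cost + 1), fun m => by rw [eval_C, timeBound]⟩
  | seq p p' hp hp' =>
    obtain ⟨q, hq⟩ := hp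
    obtain ⟨q', hq'⟩ := hp'
    exact ⟨q + q', fun m => by rw [eval_add, timeBound, hq, hq']⟩
  | ite e f p p' hp hp' =>
    obtain ⟨q, hq⟩ := hp
    obtain ⟨q', hq'⟩ := hp'
    exact ⟨C (e.cost + f.cost + 1) + (q + q'), fun m => by
      rw [eval_add, eval_add, eval_C, timeBound, hq, hq']⟩
  | loop e f p hp =>
    obtain ⟨q, hq⟩ := hp
    exact ⟨(X + 1) * (C (e.cost + f.cost + 1) + q), fun m => by
      rw [eval_mul, eval_add, eval_add, eval_C, eval_X, eval_one, timeBound, hq]⟩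

end Prog

/-- The registers and arrays in which `s` and `s'` may differ are written by the program `p`. -/
def SameFrame (p : Prog) (s s' : State) : Prop :=
  (∀ x, p.writesReg x = false → s'.reg x = s.reg x) ∧
    ∀ c, p.writesArr c = false → s'.arr c = s.arr c

theorem Run.sameFrame {p : Prog} {s s' : State} {t : ℕ} (h : Run p s t s') : SameFrame p s s' := by
  induction h with
  | skip s => exact ⟨fun _ _ => rfl, fun _ _ => rfl⟩
  | assign x e s =>
    refine ⟨fun y hy => ?_, fun _ _ => rfl⟩
    rw [State.reg_setReg, if_neg (by simpa [Prog.writesReg] using hy)]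
  | store c i e s =>
    refine ⟨fun _ _ => rfl, fun c' hc => ?_⟩
    rw [State.arr_setArr, if_neg (by simpa [Prog.writesArr] using hc)]
  | seq _ _ ihp ihq =>
    constructor
    · intro x hx
      simp only [Prog.writesReg, Bool.or_eq_false_iff] at hx
      rw [ihq.1 x hx.2, ihp.1 x hx.1]
    · intro c hc
      simp only [Prog.writesArr, Bool.or_eq_false_iff] at hc
      rw [ihq.2 c hc.2, ihp.2 c hc.1]
  | ite_true _ _ ih =>
    constructor
    · intro x hx
      simp only [Prog.writesReg, Bool.or_eq_false_iff] at hx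
      exact ih.1 x hx.1
    · intro c hc
      simp only [Prog.writesArr, Bool.or_eq_false_iff] at hc
      exact ih.2 c hc.1
  | ite_false _ _ ih =>
    constructor
    · intro x hx
      simp only [Prog.writesReg, Bool.or_eq_false_iff] at hx
      exact ih.1 x hx.2
    · intro c hc
      simp only [Prog.writesArr, Bool.or_eq_false_iff] at hc
      exact ih.2 c hc.2
  | loop_true _ _ _ ihp ihl =>
    constructor
    · intro x hx
      rw [ihl.1 x hx, ihp.1 x hx]
    · intro c hc
      rw [ihl.2 c hc, ihp.2 c hc]
  | loop_false _ => exact ⟨fun _ _ => rfl, fun _ _ => rfl⟩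

/-- Total correctness with running time: started on `s`, the program `p` halts within
`p.timeBound m` steps, with a memory content that satisfies `Q`. -/
def Halts (m : ℕ) (p : Prog) (s : State) (Q : State → Prop) : Prop :=
  ∃ t s', Run p s t s' ∧ t ≤ p.timeBound m ∧ Q s'

namespace Halts

variable {m : ℕ} {p q : Prog} {s : State} {Q Q' : State → Prop}

theorem mono (h : Halts m p s Q) (hQ : ∀ s', Q s' → Q' s') : Halts m p s Q' := by
  obtain ⟨t, s', h1, h2, h3⟩ := h
  exact ⟨t, s', h1, h2, hQ s' h3⟩

theorem frame (h : Halts m p s Q) : Halts m p s fun s' => SameFrame p s s' ∧ Q s' := by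
  obtain ⟨t, s', h1, h2, h3⟩ := h
  exact ⟨t, s', h1, h2, h1.sameFrame, h3⟩

theorem skip (h : Q s) : Halts m .skip s Q := ⟨_, _, .skip s, le_rfl, h⟩

theorem assign {x : ℕ} {e : Expr} (h : Q (s.setReg x (e.eval s))) : Halts m (.assign x e) s Q :=
  ⟨_, _, .assign x e s, le_rfl, h⟩

theorem store {c : ℕ} {i e : Expr} (h : Q (s.setArr c (i.eval s) (e.eval s))) :
    Halts m (.store c i e) s Q :=
  ⟨_, _, .store c i e s, le_rfl, h⟩

theorem seq (h : Halts m p s fun s' => Halts m q s' Q) : Halts m (.seq p q) s Q := by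
  obtain ⟨t, s', h1, h2, t', s'', h3, h4, h5⟩ := h
  exact ⟨_, _, .seq h1 h3, Nat.add_le_add h2 h4, h5⟩

theorem ite {e f : Expr} (hp : e.eval s < f.eval s → Halts m p s Q)
    (hq : ¬ e.eval s < f.eval s → Halts m q s Q) : Halts m (.ite e f p q) s Q := by
  by_cases h : e.eval s < f.eval s
  · obtain ⟨t, s', h1, h2, h3⟩ := hp h
    refine ⟨_, _, .ite_true h h1, ?_, h3⟩
    rw [Prog.timeBound]
    omega
  · obtain ⟨t, s', h1, h2, h3⟩ := hq h
    refine ⟨_, _, .ite_false h h1, ?_, h3⟩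
    rw [Prog.timeBound]
    omega

/-- The rule for loops: `J k` holds after `k` repetitions, of which there are at most `K`. -/
theorem loop {e f : Expr} {K : ℕ} (J : ℕ → State → Prop) (hK : K ≤ m) (h0 : J 0 s)
    (hstep : ∀ k s', J k s' → e.eval s' < f.eval s' → k < K ∧ Halts m p s' (J (k + 1))) :
    Halts m (.loop e f p) s fun s' => ∃ k, J k s' ∧ ¬ e.eval s' < f.eval s' := by
  have key : ∀ j k s', k + j = K → J k s' → ∃ t s'', Run (.loop e f p) s' t s'' ∧
      t ≤ (j + 1) * (e.cost + f.cost + 1 + p.timeBound m) ∧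
      ∃ k, J k s'' ∧ ¬ e.eval s'' < f.eval s'' := by
    intro j
    induction j with
    | zero =>
      intro k s' hk hJ
      by_cases h : e.eval s' < f.eval s'
      · have := (hstep k s' hJ h).1
        omega
      · exact ⟨_, _, .loop_false h, by omega, k, hJ, h⟩
    | succ j ih =>
      intro k s' hk hJ
      by_cases h : e.eval s' < f.eval s'
      · obtain ⟨-, t, s1, h1, h2, h3⟩ := hstep k s' hJ h
        obtain ⟨t', s2, h4, h5, h6⟩ := ih (k + 1) s1 (by omega) h3
        refine ⟨_, _, .loop_true h h1 h4, ?_, h6⟩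
        rw [Nat.succ_mul (j + 1)]
        omega
      · refine ⟨_, _, .loop_false h, ?_, k, hJ, h⟩
        rw [Nat.succ_mul]
        omega
  obtain ⟨t, s', h1, h2, h3⟩ := key K 0 s (by omega) h0
  exact ⟨t, s', h1, h2.trans (Nat.mul_le_mul_right _ (by omega)), h3⟩

end Halts

/-- The program that runs `p` for all values of the register `x` from `0` on that are less than the
number in the register `y`. -/
def Prog.forLoop (x y : ℕ) (p : Prog) : Prog :=
  .seq (.assign x (.const 0))
    (.loop (.reg x) (.reg y) (.seq p (.assign x (.add (.reg x) (.const 1)))))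

/-- The rule for counting loops. The invariant `J k` refers to the beginning of the pass for the
value `k` of the counter. -/
theorem Halts.forLoop {m n : ℕ} {p : Prog} {s : State} {x y : ℕ} (J : ℕ → State → Prop)
    (hxy : y ≠ x) (hy : p.writesReg y = false) (hx : p.writesReg x = false) (hn : s.reg y = n)
    (hnm : n ≤ m) (h0 : J 0 (s.setReg x 0))
    (hstep : ∀ k < n, ∀ s', SameFrame (.forLoop x y p) s s' → s'.reg x = k → J k s' →
      Halts m p s' fun s'' => J (k + 1) (s''.setReg x (k + 1))) :
    Halts m (.forLoop x y p) s fun s' => J n s' := by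
  have hwy : (Prog.forLoop x y p).writesReg y = false := by
    simp [Prog.forLoop, Prog.writesReg, hxy, hy]
  refine .seq (.assign ?_)
  refine (Halts.loop (K := n) (fun k s' => SameFrame (.forLoop x y p) s s' ∧ s'.reg x = k ∧
    k ≤ n ∧ J k s') hnm ⟨?_, ?_, Nat.zero_le n, h0⟩ ?_).mono ?_
  · refine ⟨fun z hz => ?_, fun _ _ => rfl⟩
    have : z ≠ x := by
      rintro rfl
      simp [Prog.forLoop, Prog.writesReg] at hz
    simp [this]
  · simp
  · rintro k s1 ⟨hf, hk, hkn, hJ⟩ hlt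
    simp only [Expr.eval, hk, hf.1 y hwy, hn] at hlt
    refine ⟨hlt, .seq ((hstep k hlt s1 hf hk hJ).frame.mono ?_)⟩
    rintro s2 ⟨hf', hJ'⟩
    refine .assign ?_
    have hk' : s2.reg x = k := by rw [hf'.1 x hx, hk]
    simp only [Expr.eval, hk']
    refine ⟨⟨fun z hz => ?_, fun c hc => ?_⟩, by simp, hlt, hJ'⟩
    · have hz' : z ≠ x ∧ p.writesReg z = false ∧ z ≠ x := by
        simpa [Prog.forLoop, Prog.writesReg] using hz
      rw [State.reg_setReg, if_neg hz'.1, hf'.1 z hz'.2.1, hf.1 z hz]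
    · have hc' : p.writesArr c = false := by
        simpa [Prog.forLoop, Prog.writesArr] using hc
      rw [State.arr_setReg, hf'.2 c hc', hf.2 c hc]
  · rintro s1 ⟨k, ⟨hf, hk, hkn, hJ⟩, hlt⟩
    simp only [Expr.eval, hk, hf.1 y hwy, hn, not_lt] at hlt
    rwa [le_antisymm hlt hkn]

end RAM

/-! ### The program and its correctness -/

namespace RAM

open TwoRadii Finset

-- The registers of the program.
local notation "rSize" => 0
local notation "rBig" => 1
local notation "rSmall" => 2
local notation "rCost" => 3
local notation "rRound" => 4
local notation "rVert" => 5
local notation "rLevel" => 6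
local notation "rChild" => 7
local notation "rVertRow" => 8
local notation "rChildRow" => 9
local notation "rSum" => 10
local notation "rRow" => 11
local notation "rArrive" => 12
local notation "rMin" => 13
local notation "rPay" => 14
local notation "rOut" => 15
local notation "rPos" => 16

-- The arrays of the program: the adjacency matrix and the output, the cost table, the levels.
local notation "aMain" => 0
local notation "aCost" => 1
local notation "aLevel" => 2

/-- The entry of the cost table in the row that starts at the position in `row`, for `i`. -/
def costEntry (row : ℕ) (i : Expr) : Expr := .read aCost (.add (.reg row) i)

/-- The predecessor of the number in the register `x`. -/
def predReg (x : ℕ) : Expr := .sub (.reg x) (.const 1)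

/-- The program that adds the value of `e` to the register `x`. -/
def addTo (x : ℕ) (e : Expr) : Prog := .assign x (.add (.reg x) e)

/-- The optimal decision at the vertex whose row of the cost table starts at `rRow`, if a fire
burning `rArrive` levels arrives: its cost with that of the descendants is put into `rMin`, its cost
alone into `rPay`, and the radius that is left into `rOut`. -/
def decisionProg : Prog :=
  .seq
    (.ite (costEntry rRow (predReg rBig)) (costEntry rRow (predReg rSmall))
      (.seq (.assign rMin (.add (.const 3) (costEntry rRow (predReg rBig))))
        (.seq (.assign rPay (.const 3)) (.assign rOut (predReg rBig))))
      (.seq (.assign rMin (.add (.const 2) (costEntry rRow (predReg rSmall))))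
        (.seq (.assign rPay (.const 2)) (.assign rOut (predReg rSmall)))))
    (.ite (.const 0) (.reg rArrive)
      (.ite (costEntry rRow (predReg rArrive)) (.add (.reg rMin) (.const 1))
        (.seq (.assign rMin (costEntry rRow (predReg rArrive)))
          (.seq (.assign rPay (.const 0)) (.assign rOut (predReg rArrive))))
        .skip)
      .skip)

/-- The row starting at the position `k` of the array `T`. -/
def rowAt (T : ℕ → ℕ) (k : ℕ) : ℕ → ℕ := fun i => T (k + i)

theorem halts_decisionProg (m : ℕ) {s : State} {a b row h : ℕ} (ha : s.reg rSmall = a)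
    (hb : s.reg rBig = b) (hrow : s.reg rRow = row) (hh : s.reg rArrive = h) :
    Halts m decisionProg s fun s' =>
      s'.reg rMin = minCost a b (rowAt (s.arr aCost) row) h ∧
      s'.reg rPay = pay a b (rowAt (s.arr aCost) row) h ∧
      s'.reg rOut = out a b (rowAt (s.arr aCost) row) h := by
  subst ha hb hrow hh
  set f := rowAt (s.arr aCost) (s.reg rRow) with hf
  have hf' (i) : s.arr aCost (s.reg rRow + i) = f i := rfl
  refine .seq (Halts.mono (Q := fun s' => (s'.reg rMin = newCost (s.reg rSmall) (s.reg rBig) f ∧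
    s'.reg rPay = (if f (s.reg rBig - 1) < f (s.reg rSmall - 1) then 3 else 2) ∧
    s'.reg rOut = if f (s.reg rBig - 1) < f (s.reg rSmall - 1) then s.reg rBig - 1
      else s.reg rSmall - 1) ∧
    s'.reg rArrive = s.reg rArrive ∧ s'.reg rRow = s.reg rRow ∧ s'.arr = s.arr) ?_ ?_)
  · refine .ite (fun hlt => ?_) (fun hlt => ?_)
    all_goals
      simp only [costEntry, predReg, Expr.eval, hf'] at hlt
      refine .seq (.assign (.seq (.assign (.assign ?_))))
      simp [costEntry, predReg, Expr.eval, hf', newCost, hlt]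
  · rintro s' ⟨⟨h1, h2, h3⟩, h4, h5, h6⟩
    refine .ite (fun hpos => .ite (fun hlt => ?_) fun hlt => ?_) fun hpos => .skip ?_
    all_goals simp only [Expr.eval, h4] at hpos
    all_goals try simp only [costEntry, predReg, Expr.eval, h1, h4, h5, h6, hf'] at hlt
    · have hp : Passive (s.reg rSmall) (s.reg rBig) f (s.reg rArrive) := ⟨hpos, hlt⟩
      refine .seq (.assign (.seq (.assign (.assign ?_))))
      simp [costEntry, predReg, Expr.eval, h4, h5, h6, hf', minCost, pay, out, hp]
    · have hp : ¬ Passive (s.reg rSmall) (s.reg rBig) f (s.reg rArrive) := fun hp => hlt hp.2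
      refine .skip ?_
      simp [h1, h2, h3, minCost, pay, out, hp]
    · have hp : ¬ Passive (s.reg rSmall) (s.reg rBig) f (s.reg rArrive) := fun hp => hpos hp.1
      simp [h1, h2, h3, minCost, pay, out, hp]

/-- The program that runs `p` for all vertices, with the vertex in the register `rVert` and the
beginning of its row in the matrices in the register `rVertRow`. -/
def visitProg (p : Prog) : Prog :=
  .seq (.assign rVertRow (.const 0)) (.forLoop rVert rSize (.seq p (addTo rVertRow (.reg rSize))))

/-- The rule for visiting all vertices. The invariant `J k` refers to the time before the visit to
the vertex `k`; by `hJ`, it must not depend on the registers that control the loop. -/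
theorem Halts.visit {m n : ℕ} {p : Prog} {s : State} (J : ℕ → State → Prop)
    (hw : p.writesReg rSize = false ∧ p.writesReg rVert = false ∧ p.writesReg rVertRow = false)
    (hn : s.reg rSize = n) (hnm : n ≤ m)
    (hJ : ∀ k s' u u', J k s' → J k ((s'.setReg rVertRow u).setReg rVert u')) (h0 : J 0 s)
    (hstep : ∀ k < n, ∀ s', SameFrame (visitProg p) s s' → s'.reg rVert = k →
      s'.reg rVertRow = k * n → J k s' → Halts m p s' (J (k + 1))) :
    Halts m (visitProg p) s (J n) := by
  refine .seq (.assign ?_)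
  refine (Halts.forLoop (n := n) (fun k s' => s'.reg rVertRow = k * n ∧ J k s') (by decide) ?_ ?_ ?_
    hnm ?_ ?_).mono fun s' h => h.2
  · simp [Prog.writesReg, addTo, hw]
  · simp [Prog.writesReg, addTo, hw]
  · simpa [Expr.eval] using hn
  · exact ⟨by simp [Expr.eval], hJ _ _ _ _ h0⟩
  · rintro k hk s1 hf hk1 ⟨h1, h2⟩
    refine .seq ((hstep k hk s1 ⟨fun x hx => ?_, fun c hc => ?_⟩ hk1 h1 h2).frame.mono ?_)
    · have hx' : x ≠ rVertRow ∧ (Prog.forLoop rVert rSize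
          (.seq p (addTo rVertRow (.reg rSize)))).writesReg x = false := by
        simpa [visitProg, Prog.writesReg] using hx
      rw [hf.1 x hx'.2, State.reg_setReg, if_neg hx'.1]
    · rw [hf.2 c (by simpa [visitProg, Prog.writesArr] using hc), State.arr_setReg]
    · rintro s2 ⟨hf2, h3⟩
      refine .assign ⟨?_, hJ _ _ _ _ h3⟩
      have hn1 : s1.reg rSize = n := by
        rw [hf.1 rSize (by simp [Prog.forLoop, Prog.writesReg, addTo, hw])]
        simpa [Expr.eval] using hn
      simp [Expr.eval, hf2.1 _ hw.1, hf2.1 _ hw.2.2, h1, hn1, Nat.succ_mul]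

/-! ### The cost table -/

/-- The sum of the least costs for the children of `v`, if a fire burning `j` levels arrives at
them: the adjacency matrix and the cost table are stored in the arrays `A` and `T`, row after
row. -/
def childSum (n a b : ℕ) (A T : ℕ → ℕ) (v j : ℕ) : ℕ :=
  ∑ w ∈ range n, if 0 < A (v * n + w) then minCost a b (rowAt T (w * n)) j else 0

theorem minCost_congr {n a b h : ℕ} {f f' : ℕ → ℕ} (hb : 0 < b) (hbn : b ≤ n) (hab : a ≤ b)
    (hh : h ≤ n) (hf : ∀ i < n, f i = f' i) : minCost a b f h = minCost a b f' h := by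
  simp only [minCost, Passive, newCost, hf (b - 1) (by omega), hf (a - 1) (by omega),
    hf (h - 1) (by omega)]
  congr

theorem childSum_congr {n a b v j : ℕ} {A T T' : ℕ → ℕ} (hb : 0 < b) (hbn : b ≤ n) (hab : a ≤ b)
    (hj : j ≤ n) (hT : ∀ w < n, 0 < A (v * n + w) → ∀ i < n, T (w * n + i) = T' (w * n + i)) :
    childSum n a b A T v j = childSum n a b A T' v j := by
  refine sum_congr rfl fun w hw => ?_
  split_ifs with h
  · exact minCost_congr hb hbn hab hj (hT w (mem_range.1 hw) h)
  · rfl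

/-- The program that puts into `rSum` the sum of the least costs for the children of `rVert`, if a
fire burning `rLevel` levels arrives at them. -/
def childSumProg : Prog :=
  .seq (.assign rSum (.const 0)) (.seq (.assign rChildRow (.const 0))
    (.forLoop rChild rSize (.seq
      (.ite (.const 0) (.read aMain (.add (.reg rVertRow) (.reg rChild)))
        (.seq (.assign rRow (.reg rChildRow)) (.seq (.assign rArrive (.reg rLevel))
          (.seq decisionProg (addTo rSum (.reg rMin)))))
        .skip)
      (addTo rChildRow (.reg rSize)))))

theorem halts_childSumProg {m n a b v j : ℕ} {s : State} (hn : s.reg rSize = n)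
    (ha : s.reg rSmall = a) (hb : s.reg rBig = b) (hv : s.reg rVertRow = v * n)
    (hj : s.reg rLevel = j) (hnm : n ≤ m) :
    Halts m childSumProg s fun s' =>
      s'.reg rSum = childSum n a b (s.arr aMain) (s.arr aCost) v j := by
  refine .seq (.assign (.seq (.assign ?_)))
  refine (Halts.forLoop (n := n) (fun k s' => s'.reg rChildRow = k * n ∧
    s'.reg rSum = ∑ w ∈ range k, if 0 < s.arr aMain (v * n + w) then
      minCost a b (rowAt (s.arr aCost) (w * n)) j else 0) (by decide) (by decide) (by decide) ?_
    hnm ?_ ?_).mono fun s' h => h.2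
  · simpa [Expr.eval] using hn
  · simp [Expr.eval]
  · rintro k hk s1 hf hk1 ⟨h1, h2⟩
    have e0 : s1.reg rSize = n := by rw [hf.1 _ (by decide)]; simpa [Expr.eval] using hn
    have e1 : s1.reg rSmall = a := by rw [hf.1 _ (by decide)]; simpa [Expr.eval] using ha
    have e2 : s1.reg rBig = b := by rw [hf.1 _ (by decide)]; simpa [Expr.eval] using hb
    have e3 : s1.reg rVertRow = v * n := by rw [hf.1 _ (by decide)]; simpa [Expr.eval] using hv
    have e4 : s1.reg rLevel = j := by rw [hf.1 _ (by decide)]; simpa [Expr.eval] using hj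
    have e5 : s1.arr = s.arr := by
      funext c
      rw [hf.2 c (by simp [Prog.forLoop, Prog.writesArr, decisionProg, addTo])]
      rfl
    refine .seq (Halts.mono (Q := fun s' => s'.reg rSize = n ∧ s'.reg rChildRow = k * n ∧
      s'.reg rSum = ∑ w ∈ range (k + 1), if 0 < s.arr aMain (v * n + w) then
        minCost a b (rowAt (s.arr aCost) (w * n)) j else 0) ?_ ?_)
    · rw [sum_range_succ, ← h2]
      refine .ite (fun hlt => ?_) fun hlt => .skip ?_
      all_goals simp only [Expr.eval, e3, e5, hk1] at hlt
      · refine .seq (.assign (.seq (.assign (.seq (((halts_decisionProg m (a := a) (b := b)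
          (row := k * n) (h := j) ?_ ?_ ?_ ?_).frame).mono ?_)))))
        iterate 4 simp [Expr.eval, *]
        rintro s2 ⟨hf2, h3, -⟩
        refine .assign ?_
        have g0 := hf2.1 rSize (by decide)
        have g1 := hf2.1 rChildRow (by decide)
        have g2 := hf2.1 rSum (by decide)
        simp [Expr.eval] at g0 g1 g2 h3
        simp [Expr.eval, g0, g1, g2, h3, hlt, e0, e5, h1]
      · simp [hlt, e0, h1]
    · rintro s2 ⟨h3, h4, h5⟩
      refine .assign ?_
      simp [Expr.eval, h3, h4, h5, Nat.succ_mul]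

/-- The row of the vertex `v` in the cost table agrees with the rows of its children. -/
def RowCorrect (n a b : ℕ) (A T : ℕ → ℕ) (v : ℕ) : Prop :=
  ∀ j < n, T (v * n + j) = childSum n a b A T v j

/-- The program that computes the row of `rVert` in the cost table from the rows of its children. -/
def rowProg : Prog :=
  .forLoop rLevel rSize
    (.seq childSumProg (.store aCost (.add (.reg rVertRow) (.reg rLevel)) (.reg rSum)))

theorem mul_add_ne_of_ne {n v w i j : ℕ} (hvw : w ≠ v) (hi : i < n) (hj : j < n) :
    w * n + i ≠ v * n + j := by
  intro h
  apply hvw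
  have h1 : (w * n + i) / n = w := by
    rw [Nat.add_comm, Nat.add_mul_div_right _ _ (by omega), Nat.div_eq_of_lt hi, Nat.zero_add]
  have h2 : (v * n + j) / n = v := by
    rw [Nat.add_comm, Nat.add_mul_div_right _ _ (by omega), Nat.div_eq_of_lt hj, Nat.zero_add]
  rw [← h1, h, h2]

theorem halts_rowProg {m n a b v : ℕ} {s : State} (hn : s.reg rSize = n)
    (ha : s.reg rSmall = a) (hb : s.reg rBig = b) (hv : s.reg rVertRow = v * n) (hnm : n ≤ m)
    (hb0 : 0 < b) (hbn : b ≤ n) (hab : a ≤ b)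
    (hloop : ∀ w < n, 0 < s.arr aMain (v * n + w) → w ≠ v) :
    Halts m rowProg s fun s' => RowCorrect n a b (s.arr aMain) (s'.arr aCost) v ∧
      ∀ w ≠ v, ∀ i < n, s'.arr aCost (w * n + i) = s.arr aCost (w * n + i) := by
  refine (Halts.forLoop (n := n) (fun k s' =>
    (∀ j < k, s'.arr aCost (v * n + j) = childSum n a b (s.arr aMain) (s.arr aCost) v j) ∧
    ∀ w ≠ v, ∀ i < n, s'.arr aCost (w * n + i) = s.arr aCost (w * n + i))
    (by decide) (by decide) (by decide) hn hnm ⟨by simp, by simp⟩ ?_).mono ?_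
  · rintro k hk s1 hf hk1 ⟨h1, h2⟩
    have e0 : s1.reg rSize = n := by rw [hf.1 _ (by decide), hn]
    have e1 : s1.reg rSmall = a := by rw [hf.1 _ (by decide), ha]
    have e2 : s1.reg rBig = b := by rw [hf.1 _ (by decide), hb]
    have e3 : s1.reg rVertRow = v * n := by rw [hf.1 _ (by decide), hv]
    have e4 : s1.arr aMain = s.arr aMain := hf.2 _ (by decide)
    refine .seq ((halts_childSumProg e0 e1 e2 e3 hk1 hnm).frame.mono ?_)
    rintro s2 ⟨hf2, h3⟩
    refine .store ?_
    have h4 : s2.arr aCost = s1.arr aCost := hf2.2 _ (by decide)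
    have h5 : s2.reg rVertRow = v * n := by rw [hf2.1 _ (by decide), e3]
    have h6 : s2.reg rLevel = k := by rw [hf2.1 _ (by decide), hk1]
    rw [e4, childSum_congr hb0 hbn hab hk.le fun w hw hvw i hi => h2 w (hloop w hw hvw) i hi] at h3
    simp only [State.arr_setReg, State.arr_setArr_self, Expr.eval, h3, h4, h5, h6]
    constructor
    · intro j hj
      rcases Nat.lt_succ_iff_lt_or_eq.1 hj with hj | rfl
      · rw [Function.update_of_ne (by omega), h1 j hj]
      · rw [Function.update_self]
    · intro w hw i hi
      rw [Function.update_of_ne (mul_add_ne_of_ne hw hi hk), h2 w hw i hi]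
  · rintro s' ⟨h1, h2⟩
    refine ⟨fun j hj => ?_, h2⟩
    rw [h1 j hj]
    exact childSum_congr hb0 hbn hab hj.le
      fun w hw hvw i hi => (h2 w (hloop w hw hvw) i hi).symm

/-- `d` is a depth function on the vertices of the forest with the adjacency matrix stored in `A`,
row after row. -/
structure IsForest (n : ℕ) (A d : ℕ → ℕ) : Prop where
  depth_succ {v w : ℕ} : v < n → w < n → 0 < A (v * n + w) → d w = d v + 1
  depth_lt {v : ℕ} : v < n → d v < n
  parent_unique {u v w : ℕ} : u < n → v < n → w < n → 0 < A (u * n + w) → 0 < A (v * n + w) → u = v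

/-- The program that computes the cost table. Each pass computes the rows of all vertices in an
arbitrary order; after `t` passes, the rows of the vertices of depth at least `n - t` are
correct. -/
def tableProg : Prog := .forLoop rRound rSize (visitProg rowProg)

/-- Recomputing the row of `v` in place does not spoil a correct row of `u`: if `v` is a child
of `u`, then the row of `v` was already correct and does not change. -/
theorem RowCorrect.update {n a b u v : ℕ} {A T T' d : ℕ → ℕ} (hA : IsForest n A d) (hb0 : 0 < b)
    (hbn : b ≤ n) (hab : a ≤ b) (hv : v < n) (h : RowCorrect n a b A T u)
    (hT' : RowCorrect n a b A T' v) (hTT' : ∀ w ≠ v, ∀ i < n, T' (w * n + i) = T (w * n + i))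
    (hchild : 0 < A (u * n + v) → RowCorrect n a b A T v) : RowCorrect n a b A T' u := by
  have hne {x w : ℕ} (hx : x < n) (hw : w < n) (e : 0 < A (x * n + w)) : w ≠ x := by
    rintro rfl
    have := hA.depth_succ hx hw e
    omega
  by_cases huv : u = v
  · exact huv ▸ hT'
  · intro j hj
    rw [hTT' u huv j hj, h j hj]
    refine childSum_congr hb0 hbn hab hj.le fun w hw e i hi => ?_
    by_cases hwv : w = v
    · subst hwv
      rw [hT' i hi, hchild e i hi]
      exact childSum_congr hb0 hbn hab hi.le
        fun x hx e' i' hi' => (hTT' x (hne hv hx e') i' hi').symm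
    · exact (hTT' w hwv i hi).symm

theorem halts_tableProg {m n a b : ℕ} {s : State} {d : ℕ → ℕ} (hn : s.reg rSize = n)
    (ha : s.reg rSmall = a) (hb : s.reg rBig = b) (hnm : n ≤ m)
    (hb0 : 0 < b) (hbn : b ≤ n) (hab : a ≤ b) (hA : IsForest n (s.arr aMain) d) :
    Halts m tableProg s fun s' =>
      ∀ v < n, RowCorrect n a b (s.arr aMain) (s'.arr aCost) v := by
  refine (Halts.forLoop (n := n) (fun t s' => ∀ v < n, n - t ≤ d v →
    RowCorrect n a b (s.arr aMain) (s'.arr aCost) v)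
    (by decide) (by decide) (by decide) hn hnm ?_ ?_).mono ?_
  · intro v hv h
    have := hA.depth_lt hv
    omega
  · intro t ht s1 hf _ h1
    refine (Halts.visit (fun k s' => ∀ v < n, n - t ≤ d v ∨ (v < k ∧ n - (t + 1) ≤ d v) →
      RowCorrect n a b (s.arr aMain) (s'.arr aCost) v) (by decide) (n := n) ?_ hnm
      (fun k s' u u' h => h) ?_ ?_).mono ?_
    · rw [hf.1 _ (by decide), hn]
    · rintro v hv (h | h)
      · exact h1 v hv h
      · omega
    · intro k hk s2 hf2 hk2 hrow h2
      have e0 : s2.reg rSize = n := by rw [hf2.1 _ (by decide), hf.1 _ (by decide), hn]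
      have e1 : s2.reg rSmall = a := by rw [hf2.1 _ (by decide), hf.1 _ (by decide), ha]
      have e2 : s2.reg rBig = b := by rw [hf2.1 _ (by decide), hf.1 _ (by decide), hb]
      have e3 : s2.arr aMain = s.arr aMain := by rw [hf2.2 _ (by decide), hf.2 _ (by decide)]
      refine (halts_rowProg e0 e1 e2 hrow hnm hb0 hbn hab ?_).mono ?_
      · rintro w hw hkw rfl
        rw [e3] at hkw
        have := hA.depth_succ hk hw hkw
        omega
      · rintro s3 ⟨h3, h4⟩ v hv hd
        rw [e3] at h3
        by_cases hvk : v = k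
        · rwa [hvk]
        · refine (h2 v hv (by omega)).update hA hb0 hbn hab hk h3 h4 fun e => ?_
          have := hA.depth_succ hv hk e
          exact h2 k hk (by omega)
    · intro s2 h2 v hv hd
      exact h2 v hv (Or.inr ⟨hv, hd⟩)
  · intro s' h v hv
    exact h v hv (by omega)

/-! ### The levels of the fires -/

/-- The program that puts the optimal decision at `rVert` into `rMin`, `rPay` and `rOut`. -/
def decideProg : Prog :=
  .seq (.assign rRow (.reg rVertRow))
    (.seq (.assign rArrive (.read aLevel (.reg rVert))) decisionProg)

theorem halts_decideProg (m : ℕ) {s : State} {a b n v : ℕ} (ha : s.reg rSmall = a)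
    (hb : s.reg rBig = b) (hrow : s.reg rVertRow = v * n) (hv : s.reg rVert = v) :
    Halts m decideProg s fun s' => SameFrame decideProg s s' ∧
      s'.reg rPay = pay a b (rowAt (s.arr aCost) (v * n)) (s.arr aLevel v) ∧
      s'.reg rOut = out a b (rowAt (s.arr aCost) (v * n)) (s.arr aLevel v) := by
  refine Halts.frame (.seq (.assign (.seq (.assign ((halts_decisionProg m (a := a) (b := b)
    (row := v * n) (h := s.arr aLevel v) ?_ ?_ ?_ ?_).mono ?_)))))
  iterate 4 simp [Expr.eval, *]
  exact fun s' h => h.2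

/-- The program that sets the level of all children of `rVert` to `rOut`. -/
def spreadProg : Prog :=
  .forLoop rChild rSize
    (.ite (.const 0) (.read aMain (.add (.reg rVertRow) (.reg rChild)))
      (.store aLevel (.reg rChild) (.reg rOut)) .skip)

theorem halts_spreadProg {m n v o : ℕ} {s : State} (hn : s.reg rSize = n)
    (hv : s.reg rVertRow = v * n) (ho : s.reg rOut = o) (hnm : n ≤ m) :
    Halts m spreadProg s fun s' => ∀ w < n,
      s'.arr aLevel w = if 0 < s.arr aMain (v * n + w) then o else s.arr aLevel w := by
  refine (Halts.forLoop (n := n) (fun k s' => ∀ w, s'.arr aLevel w =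
    if w < k ∧ 0 < s.arr aMain (v * n + w) then o else s.arr aLevel w)
    (by decide) (by decide) (by decide) hn hnm ?_ ?_).mono ?_
  · simp
  · intro k hk s1 hf hk1 h1
    have e1 : s1.reg rVertRow = v * n := by rw [hf.1 _ (by decide), hv]
    have e2 : s1.reg rOut = o := by rw [hf.1 _ (by decide), ho]
    have e3 : s1.arr aMain = s.arr aMain := hf.2 _ (by decide)
    refine .ite (fun hlt => .store ?_) fun hlt => .skip ?_
    all_goals
      simp only [Expr.eval, e1, e3, hk1] at hlt
      intro w
      rcases eq_or_ne w k with rfl | hw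
    · simp [Expr.eval, hk1, e2, hlt]
    · have : w < k + 1 ↔ w < k := by omega
      simp [Expr.eval, hk1, e2, hw, h1, this]
    · simp [h1, hlt]
    · have : w < k + 1 ↔ w < k := by omega
      simp [h1, this]
  · intro s' h w hw
    rw [h]
    simp [hw]

/-- The program that computes the levels from the cost table. Each pass computes the levels of the
children of all vertices in an arbitrary order; after `t` passes, the levels of the vertices
of depth at most `t` are correct. -/
def levelProg : Prog :=
  .forLoop rRound rSize (visitProg (.seq decideProg spreadProg))

/-- The levels of the children of `v` agree with the level of `v`. -/
def LevelCorrect (n a b : ℕ) (A T F : ℕ → ℕ) (v : ℕ) : Prop :=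
  ∀ w < n, 0 < A (v * n + w) → F w = out a b (rowAt T (v * n)) (F v)

theorem halts_levelProg {m n a b : ℕ} {s : State} {d : ℕ → ℕ} (hn : s.reg rSize = n)
    (ha : s.reg rSmall = a) (hb : s.reg rBig = b) (hnm : n ≤ m)
    (hA : IsForest n (s.arr aMain) d) :
    Halts m levelProg s fun s' =>
      (∀ v < n, LevelCorrect n a b (s.arr aMain) (s.arr aCost) (s'.arr aLevel) v) ∧
      ∀ r < n, (∀ v < n, ¬ 0 < s.arr aMain (v * n + r)) → s'.arr aLevel r = s.arr aLevel r := by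
  refine (Halts.forLoop (n := n) (fun t s' =>
      (∀ v < n, d v < t → LevelCorrect n a b (s.arr aMain) (s.arr aCost) (s'.arr aLevel) v) ∧
      ∀ r < n, (∀ v < n, ¬ 0 < s.arr aMain (v * n + r)) → s'.arr aLevel r = s.arr aLevel r)
    (by decide) (by decide) (by decide) hn hnm ?_ ?_).mono ?_
  · simp
  · rintro t ht s1 hf - h1
    refine (Halts.visit (fun k s' =>
      (∀ v < n, d v < t ∨ (v < k ∧ d v < t + 1) →
        LevelCorrect n a b (s.arr aMain) (s.arr aCost) (s'.arr aLevel) v) ∧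
      ∀ r < n, (∀ v < n, ¬ 0 < s.arr aMain (v * n + r)) → s'.arr aLevel r = s.arr aLevel r)
      (by decide) (n := n) ?_ hnm (fun k s' u u' h => h) ?_ ?_).mono ?_
    · rw [hf.1 _ (by decide), hn]
    · refine ⟨?_, h1.2⟩
      rintro v hv (h | h)
      · exact h1.1 v hv h
      · omega
    · rintro k hk s2 hf2 hk2 hrow ⟨h2, h2r⟩
      have e1 : s2.reg rSmall = a := by rw [hf2.1 _ (by decide), hf.1 _ (by decide), ha]
      have e2 : s2.reg rBig = b := by rw [hf2.1 _ (by decide), hf.1 _ (by decide), hb]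
      have e3 : s2.arr aMain = s.arr aMain := by rw [hf2.2 _ (by decide), hf.2 _ (by decide)]
      have e4 : s2.arr aCost = s.arr aCost := by rw [hf2.2 _ (by decide), hf.2 _ (by decide)]
      refine .seq ((halts_decideProg m e1 e2 hrow hk2).mono ?_)
      rintro s3 ⟨hf3, -, h3⟩
      have g0 : s3.reg rSize = n := by
        rw [hf3.1 _ (by decide), hf2.1 _ (by decide), hf.1 _ (by decide), hn]
      have g1 : s3.reg rVertRow = k * n := by rw [hf3.1 _ (by decide), hrow]
      have g2 : s3.arr aMain = s.arr aMain := by rw [hf3.2 _ (by decide), e3]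
      have g3 : s3.arr aLevel = s2.arr aLevel := hf3.2 _ (by decide)
      rw [e4] at h3
      refine (halts_spreadProg g0 g1 h3 hnm).mono ?_
      intro s4 h4
      rw [g2, g3] at h4
      constructor
      · intro v hv hd w hw e
        by_cases hvk : v = k
        · subst hvk
          have hvv : ¬ 0 < s.arr aMain (v * n + v) := fun e' => by
            have := hA.depth_succ hv hv e'
            omega
          rw [h4 w hw, h4 v hv, if_pos e, if_neg hvv]
        · have hv' := h2 v hv (by omega)
          have hkw : ¬ 0 < s.arr aMain (k * n + w) := fun e' =>
            hvk (hA.parent_unique hv hk hw e e')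
          rw [h4 w hw, if_neg hkw, h4 v hv, hv' w hw e]
          split_ifs with e'
          · -- The level of `v` was already correct and does not change.
            have := hA.depth_succ hk hv e'
            rw [h2 k hk (by omega) v hv e']
          · rfl
      · intro r hr hroot
        rw [h4 r hr, if_neg (hroot k hk), h2r r hr hroot]
    · rintro s2 ⟨h2, h2r⟩
      exact ⟨fun v hv hd => h2 v hv (Or.inr ⟨hv, hd⟩), h2r⟩
  · rintro s' ⟨h, hr⟩
    exact ⟨fun v hv => h v hv (hA.depth_lt hv), hr⟩

/-! ### The search for the number of rounds -/

/-- The cost of the fire at `v`, read off the cost table `T` and the levels `F`. -/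
def payAt (n a b : ℕ) (T F : ℕ → ℕ) (v : ℕ) : ℕ := pay a b (rowAt T (v * n)) (F v)

/-- The program that puts the total cost of the fires into `rCost`. -/
def costProg : Prog :=
  .seq (.assign rCost (.const 0)) (visitProg (.seq decideProg (addTo rCost (.reg rPay))))

theorem halts_costProg {m n a b : ℕ} {s : State} (hn : s.reg rSize = n)
    (ha : s.reg rSmall = a) (hb : s.reg rBig = b) (hnm : n ≤ m) :
    Halts m costProg s fun s' =>
      s'.reg rCost = ∑ v ∈ range n, payAt n a b (s.arr aCost) (s.arr aLevel) v := by
  refine .seq (.assign ?_)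
  refine Halts.visit (n := n) (fun k s' =>
    s'.reg rCost = ∑ v ∈ range k, payAt n a b (s.arr aCost) (s.arr aLevel) v)
    (by decide) (by simpa using hn) hnm (fun k s' u u' h => by simpa using h)
    (by simp [Expr.eval]) ?_
  intro k hk s1 hf hk1 hrow h1
  have e1 : s1.reg rSmall = a := by rw [hf.1 _ (by decide)]; simpa using ha
  have e2 : s1.reg rBig = b := by rw [hf.1 _ (by decide)]; simpa using hb
  have e3 : s1.arr aCost = s.arr aCost := hf.2 _ (by decide)
  have e4 : s1.arr aLevel = s.arr aLevel := hf.2 _ (by decide)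
  refine .seq ((halts_decideProg m e1 e2 hrow hk1).mono ?_)
  rintro s2 ⟨hf2, h2, -⟩
  refine .assign ?_
  have e5 := hf2.1 rCost (by decide)
  rw [e3, e4] at h2
  simp [Expr.eval, e5, h1, h2, sum_range_succ, payAt]

/-- The program that computes a cheapest solution for the radii `rBig - 1` and `rSmall - 1`. -/
def solveProg : Prog := .seq tableProg (.seq levelProg costProg)

/-- The memory content `s` holds a cheapest solution for the radii `b - 1` and `a - 1`. -/
structure Solved (n a b : ℕ) (A : ℕ → ℕ) (s : State) : Prop where
  row {v : ℕ} : v < n → RowCorrect n a b A (s.arr aCost) v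
  level {v : ℕ} : v < n → LevelCorrect n a b A (s.arr aCost) (s.arr aLevel) v
  root {r : ℕ} : r < n → (∀ v < n, ¬ 0 < A (v * n + r)) → s.arr aLevel r = 0
  cost : s.reg rCost = ∑ v ∈ range n, payAt n a b (s.arr aCost) (s.arr aLevel) v

theorem halts_solveProg {m n a b : ℕ} {s : State} {d : ℕ → ℕ} (hn : s.reg rSize = n)
    (ha : s.reg rSmall = a) (hb : s.reg rBig = b) (hnm : n ≤ m) (hb0 : 0 < b) (hbn : b ≤ n)
    (hab : a ≤ b) (hA : IsForest n (s.arr aMain) d)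
    (hroot : ∀ r < n, (∀ v < n, ¬ 0 < s.arr aMain (v * n + r)) → s.arr aLevel r = 0) :
    Halts m solveProg s (Solved n a b (s.arr aMain)) := by
  refine .seq ((halts_tableProg hn ha hb hnm hb0 hbn hab hA).frame.mono ?_)
  rintro s1 ⟨hf1, h1⟩
  have e0 : s1.reg rSize = n := by rw [hf1.1 _ (by decide), hn]
  have e1 : s1.reg rSmall = a := by rw [hf1.1 _ (by decide), ha]
  have e2 : s1.reg rBig = b := by rw [hf1.1 _ (by decide), hb]
  have e3 : s1.arr aMain = s.arr aMain := hf1.2 _ (by decide)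
  have e4 : s1.arr aLevel = s.arr aLevel := hf1.2 _ (by decide)
  refine .seq ((halts_levelProg e0 e1 e2 hnm (e3.symm ▸ hA)).frame.mono ?_)
  rintro s2 ⟨hf2, h2, h2r⟩
  have g0 : s2.reg rSize = n := by rw [hf2.1 _ (by decide), e0]
  have g1 : s2.reg rSmall = a := by rw [hf2.1 _ (by decide), e1]
  have g2 : s2.reg rBig = b := by rw [hf2.1 _ (by decide), e2]
  have g3 : s2.arr aCost = s1.arr aCost := hf2.2 _ (by decide)
  refine (halts_costProg g0 g1 g2 hnm).frame.mono ?_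
  rintro s3 ⟨hf3, h3⟩
  have k1 : s3.arr aCost = s1.arr aCost := by rw [hf3.2 _ (by decide), g3]
  have k2 : s3.arr aLevel = s2.arr aLevel := hf3.2 _ (by decide)
  rw [e3] at h2 h2r
  rw [g3] at h3
  constructor
  · rw [k1]; exact h1 _
  · rw [k1, k2]; exact h2 _
  · intro r hr h
    rw [k2, h2r r hr h, e4, hroot r hr h]
  · rw [k1, k2, h3]

/-- The sum of `c` copies of the expression `e`. -/
def mulExpr : ℕ → Expr → Expr
  | 0, _ => .const 0
  | c + 1, e => .add (mulExpr c e) e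

@[simp] theorem eval_mulExpr (s : State) (c : ℕ) (e : Expr) :
    (mulExpr c e).eval s = c * e.eval s := by
  induction c with
  | zero => simp [mulExpr, Expr.eval]
  | succ c ih => rw [mulExpr, Expr.eval, ih, Nat.succ_mul]

/-- The program that increases `rBig` step by step, with `rSmall` as its half, until the cheapest
solution costs at most as much as the fires of radii `0, …, rBig - 1`. -/
def searchProg : Prog :=
  -- With this cost, the loop is entered for `rBig = 0`.
  .seq (.assign rCost (.const 1))
    (.loop (mulExpr 3 (.reg rBig)) (.add (.reg rCost) (.reg rSmall))
      (.seq (addTo rBig (.const 1))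
        (.seq (.ite (.add (mulExpr 2 (.reg rSmall)) (.const 1)) (.reg rBig)
          (addTo rSmall (.const 1)) .skip) solveProg)))

/-- The memory content reached by the search. -/
structure Found (n N b : ℕ) (A : ℕ → ℕ) (s : State) : Prop where
  size : s.reg rSize = n
  big : s.reg rBig = b
  small : s.reg rSmall = b / 2
  pos : 0 < b
  le : b ≤ N
  solved : Solved n (b / 2) b A s
  cost_le : s.reg rCost + b / 2 ≤ 3 * b

theorem halts_searchProg {m n N : ℕ} {s : State} {d : ℕ → ℕ} (hn : s.reg rSize = n)
    (ha : s.reg rSmall = 0) (hb : s.reg rBig = 0) (hnm : n ≤ m) (hN : 0 < N) (hNn : N ≤ n)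
    (hA : IsForest n (s.arr aMain) d) (hlevel : ∀ v, s.arr aLevel v = 0)
    (hopt : ∀ s', Solved n (N / 2) N (s.arr aMain) s' → s'.reg rCost + N / 2 ≤ 3 * N) :
    Halts m searchProg s fun s' => ∃ b, Found n N b (s.arr aMain) s' := by
  refine .seq (.assign ?_)
  refine (Halts.loop (K := N) (fun b s' => s'.reg rSize = n ∧ s'.reg rBig = b ∧
    s'.reg rSmall = b / 2 ∧ s'.arr aMain = s.arr aMain ∧
    (∀ r < n, (∀ v < n, ¬ 0 < s.arr aMain (v * n + r)) → s'.arr aLevel r = 0) ∧ b ≤ N ∧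
    (b = 0 ∧ s'.reg rCost = 1 ∨ 0 < b ∧ Solved n (b / 2) b (s.arr aMain) s'))
    (hNn.trans hnm) ?_ ?_).mono ?_
  · simp [Expr.eval, *]
  · rintro b s1 ⟨h0, h1, h2, h3, h4, h5, h6⟩ hlt
    have hbN : b < N := by
      refine lt_of_le_of_ne h5 ?_
      rintro rfl
      have := hopt s1 (h6.resolve_left (by omega)).2
      simp only [eval_mulExpr, Expr.eval, h1, h2] at hlt
      omega
    refine ⟨hbN, .seq (.assign (.seq (Halts.mono (Q := fun s' => s'.reg rSize = n ∧
      s'.reg rBig = b + 1 ∧ s'.reg rSmall = (b + 1) / 2 ∧ s'.arr = s1.arr) ?_ ?_)))⟩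
    · refine .ite (fun h => .assign ?_) fun h => .skip ?_
      all_goals
        simp [Expr.eval, h1, h2] at h
        simp [Expr.eval, h0, h1, h2]
        omega
    · rintro s2 ⟨g0, g1, g2, g3⟩
      have g4 : s2.arr aMain = s.arr aMain := by rw [g3, h3]
      refine (halts_solveProg g0 g2 g1 hnm (by omega) (by omega) (by omega) (g4.symm ▸ hA)
        ?_).frame.mono ?_
      · rw [g4, g3]
        exact h4
      · rintro s3 ⟨hf3, h7⟩
        rw [g4] at h7
        exact ⟨by rw [hf3.1 _ (by decide), g0], by rw [hf3.1 _ (by decide), g1],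
          by rw [hf3.1 _ (by decide), g2], by rw [hf3.2 _ (by decide), g4],
          fun r hr h => h7.root hr h, hbN, Or.inr ⟨by omega, h7⟩⟩
  · rintro s1 ⟨b, ⟨h0, h1, h2, h3, h4, h5, h6⟩, hlt⟩
    simp only [eval_mulExpr, Expr.eval, h1, h2] at hlt
    have hb0 : b ≠ 0 := by
      rintro rfl
      omega
    exact ⟨b, h0, h1, h2, by omega, h5, (h6.resolve_left (by omega)).2, by omega⟩

/-! ### The output -/

/-- The list `L` is stored at the beginning of the output array, and its length in `rPos`. -/
def Stores (L : List ℕ) (s : State) : Prop :=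
  s.reg rPos = L.length ∧ ∀ i (h : i < L.length), s.arr aMain i = L[i]

/-- The program that appends the value of `e` to the output. -/
def pushProg (e : Expr) : Prog :=
  .seq (.store aMain (.reg rPos) e) (addTo rPos (.const 1))

theorem halts_pushProg (m : ℕ) {s : State} {L : List ℕ} {e : Expr} (h : Stores L s) :
    Halts m (pushProg e) s (Stores (L ++ [e.eval s])) := by
  refine .seq (.store (.assign ⟨?_, fun i hi => ?_⟩))
  · simp [Expr.eval, h.1]
  · simp only [Expr.eval, h.1, State.arr_setReg, State.arr_setArr_self]
    rw [List.length_append, List.length_singleton] at hi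
    rcases Nat.lt_succ_iff_lt_or_eq.1 hi with hi | rfl
    · rw [Function.update_of_ne (by omega), List.getElem_append_left hi, h.2 i hi]
    · simp

/-- The program that appends to the output all vertices at which a fire of cost `c` is lit. -/
def outputFiresProg (c : ℕ) : Prog :=
  visitProg (.seq decideProg
    (.ite (.reg rPay) (.const c) .skip
      (.ite (.const c) (.reg rPay) .skip (pushProg (.reg rVert)))))

/-- The vertices at which a fire of cost `c` is lit. -/
def fires (n a b : ℕ) (T F : ℕ → ℕ) (c k : ℕ) : List ℕ :=
  (List.range k).filter fun v => payAt n a b T F v = c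

theorem halts_outputFiresProg {m n a b : ℕ} (c : ℕ) {s : State} {L : List ℕ}
    (hn : s.reg rSize = n) (ha : s.reg rSmall = a) (hb : s.reg rBig = b) (hnm : n ≤ m)
    (hL : Stores L s) :
    Halts m (outputFiresProg c) s
      (Stores (L ++ fires n a b (s.arr aCost) (s.arr aLevel) c n)) := by
  refine Halts.visit (n := n) (fun k s' =>
    Stores (L ++ fires n a b (s.arr aCost) (s.arr aLevel) c k) s')
    ⟨rfl, rfl, rfl⟩ hn hnm (fun k s' u u' h => by simpa [Stores] using h)
    (by simpa [fires] using hL) ?_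
  intro k hk s1 hf hk1 hrow h1
  have e1 : s1.reg rSmall = a := by rw [hf.1 _ rfl, ha]
  have e2 : s1.reg rBig = b := by rw [hf.1 _ rfl, hb]
  have e3 : s1.arr aCost = s.arr aCost := hf.2 _ rfl
  have e4 : s1.arr aLevel = s.arr aLevel := hf.2 _ rfl
  refine .seq ((halts_decideProg m e1 e2 hrow hk1).mono ?_)
  rintro s2 ⟨hf2, h2, -⟩
  have h2' : s2.reg rPay = payAt n a b (s.arr aCost) (s.arr aLevel) k := by rw [h2, e3, e4]; rfl
  have h3 : Stores (L ++ fires n a b (s.arr aCost) (s.arr aLevel) c k) s2 := by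
    refine ⟨by rw [hf2.1 _ rfl, h1.1], fun i hi => ?_⟩
    rw [hf2.2 _ rfl, h1.2 i hi]
  have hsucc : fires n a b (s.arr aCost) (s.arr aLevel) c (k + 1) =
      fires n a b (s.arr aCost) (s.arr aLevel) c k ++
        if payAt n a b (s.arr aCost) (s.arr aLevel) k = c then [k] else [] := by
    rw [fires, List.range_succ, List.filter_append, fires]
    split_ifs with h <;> simp [h]
  rw [hsucc]
  refine .ite (fun hlt => .skip ?_) fun hlt => .ite (fun hlt' => .skip ?_) fun hlt' => ?_
  · simp only [Expr.eval, h2'] at hlt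
    rw [if_neg (by omega), List.append_nil]
    exact h3
  · simp only [Expr.eval, h2'] at hlt'
    rw [if_neg (by omega), List.append_nil]
    exact h3
  · simp only [Expr.eval, h2'] at hlt hlt'
    rw [if_pos (by omega), ← List.append_assoc]
    have h4 := halts_pushProg m (e := .reg rVert) h3
    rwa [Expr.eval, hf2.1 _ rfl, hk1] at h4

/-- The program that outputs the vertices of the large fires, those of the small ones, and then the
vertex `0` again and again, up to the length `11 / 6 * rBig`, rounded down. -/
def outputProg : Prog :=
  .seq (outputFiresProg 3) (.seq (outputFiresProg 2)
    (.seq (.loop (.add (mulExpr 6 (.reg rPos)) (.const 5)) (mulExpr 11 (.reg rBig))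
      (pushProg (.const 0))) (.assign rSize (.reg rPos))))

theorem halts_outputProg {m n a b : ℕ} {s : State} (hn : s.reg rSize = n)
    (ha : s.reg rSmall = a) (hb : s.reg rBig = b) (hpos : s.reg rPos = 0) (hnm : 2 * n ≤ m)
    (hbn : b ≤ n)
    (hle : 6 * ((fires n a b (s.arr aCost) (s.arr aLevel) 3 n).length +
      (fires n a b (s.arr aCost) (s.arr aLevel) 2 n).length) ≤ 11 * b) :
    Halts m outputProg s fun s' => ∃ L : List ℕ,
      (s'.reg 0 = L.length ∧ ∀ i (h : i < L.length), s'.arr 0 i = L[i]) ∧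
      (∃ c, L = fires n a b (s.arr aCost) (s.arr aLevel) 3 n ++
        (fires n a b (s.arr aCost) (s.arr aLevel) 2 n ++ List.replicate c 0)) ∧
      6 * L.length ≤ 11 * b ∧ 11 * b ≤ 6 * L.length + 5 := by
  have h0 : Stores [] s := ⟨hpos, by simp⟩
  refine .seq ((halts_outputFiresProg 3 hn ha hb (by omega) h0).frame.mono ?_)
  rintro s1 ⟨hf1, h1⟩
  have e0 : s1.reg rSize = n := by rw [hf1.1 _ rfl, hn]
  have e1 : s1.reg rSmall = a := by rw [hf1.1 _ rfl, ha]
  have e2 : s1.reg rBig = b := by rw [hf1.1 _ rfl, hb]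
  have e3 : s1.arr aCost = s.arr aCost := hf1.2 _ rfl
  have e4 : s1.arr aLevel = s.arr aLevel := hf1.2 _ rfl
  refine .seq ((halts_outputFiresProg 2 e0 e1 e2 (by omega) h1).frame.mono ?_)
  rintro s2 ⟨hf2, h2⟩
  have g2 : s2.reg rBig = b := by rw [hf2.1 _ rfl, e2]
  rw [e3, e4, List.nil_append] at h2
  refine .seq ((Halts.loop (K := 2 * n) (fun c s' => s'.reg rBig = b ∧
    Stores (fires n a b (s.arr aCost) (s.arr aLevel) 3 n ++
      (fires n a b (s.arr aCost) (s.arr aLevel) 2 n ++ List.replicate c 0)) s' ∧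
    6 * s'.reg rPos ≤ 11 * b ∧ c ≤ s'.reg rPos) hnm ⟨g2, by simpa using h2, ?_, Nat.zero_le _⟩
      ?_).mono ?_)
  · rw [h2.1, List.length_append]
    exact hle
  · rintro c s3 ⟨h3, h4, h5, h6⟩ hlt
    simp only [eval_mulExpr, Expr.eval, h3] at hlt
    refine ⟨by omega, (halts_pushProg m h4).frame.mono ?_⟩
    rintro s4 ⟨hf4, h7⟩
    have h8 : s4.reg rPos = s3.reg rPos + 1 := by
      rw [h7.1, List.length_append, ← h4.1]
      rfl
    refine ⟨by rw [hf4.1 _ rfl, h3], ?_, by omega, by omega⟩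
    simpa [List.replicate_succ', Expr.eval] using h7
  · rintro s3 ⟨c, ⟨h3, h4, h5, -⟩, hlt⟩
    simp only [eval_mulExpr, Expr.eval, h3] at hlt
    refine .assign ⟨_, ⟨?_, h4.2⟩, ⟨c, rfl⟩, ?_, ?_⟩
    · simp [Expr.eval, h4.1]
    · rw [← h4.1]
      exact h5
    · rw [← h4.1]
      omega

/-- The approximation algorithm for the burning number of arborescences. -/
def burnProg : Prog := .seq searchProg outputProg

/-! ### The approximation ratio -/

variable {n : ℕ} {G : Digraph (Fin n)} {r : Fin n} {d : Fin n → ℕ}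

theorem arr_digraphInput_pos_iff (G : Digraph (Fin n)) (v w : Fin n) :
    0 < (digraphInput G).arr aMain (v * n + w) ↔ G.Adj v w := by
  simp only [digraphInput]
  split_ifs with h
  · obtain ⟨-, i, j, hij, e⟩ := h
    have hi : i = v := by
      by_contra hne
      exact mul_add_ne_of_ne (fun h => hne (Fin.ext h.symm)) w.2 j.2 hij
    subst hi
    have hj : j = w := Fin.ext (by omega)
    simpa [hj] using e
  · simp only [lt_self_iff_false, false_iff]
    exact fun e => h ⟨rfl, v, w, rfl, e⟩

theorem isForest_digraphInput (hG : G.IsRooted r d) :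
    IsForest n ((digraphInput G).arr aMain) fun v => if h : v < n then d ⟨v, h⟩ else 0 := by
  refine ⟨fun {v w} hv hw e => ?_, fun {v} hv => ?_, fun {u v w} hu hv hw e e' => ?_⟩
  · rw [dif_pos hv, dif_pos hw]
    exact hG.depth_succ ((arr_digraphInput_pos_iff G ⟨v, hv⟩ ⟨w, hw⟩).1 e)
  · rw [dif_pos hv]
    exact hG.depth_lt _
  · have h1 := (arr_digraphInput_pos_iff G ⟨u, hu⟩ ⟨w, hw⟩).1 e
    have h2 := (arr_digraphInput_pos_iff G ⟨v, hv⟩ ⟨w, hw⟩).1 e'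
    have hwr : (⟨w, hw⟩ : Fin n) ≠ r := fun h => hG.not_adj_root _ (h ▸ h1)
    exact Fin.mk.inj_iff.1 ((hG.existsUnique_parent _ hwr).unique h1 h2)

variable {a b : ℕ} {s : State}

theorem Solved.isCostTable (h : Solved n a b ((digraphInput G).arr aMain) s) (hbn : b ≤ n) :
    IsCostTable G a b fun v => rowAt (s.arr aCost) (v * n) := by
  intro v j hj
  refine (h.row v.2 j (by omega)).trans ?_
  rw [childSum, sum_range]
  classical
  exact sum_congr rfl fun w _ => if_congr (arr_digraphInput_pos_iff G v w) rfl rfl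

theorem Solved.isLevelFunction (h : Solved n a b ((digraphInput G).arr aMain) s) :
    IsLevelFunction G a b (fun v => rowAt (s.arr aCost) (v * n)) fun v => s.arr aLevel v :=
  fun v w e => h.level v.2 w w.2 ((arr_digraphInput_pos_iff G v w).2 e)

theorem Solved.level_root (h : Solved n a b ((digraphInput G).arr aMain) s) (hG : G.IsRooted r d) :
    s.arr aLevel r = 0 :=
  h.root r.2 fun v hv e => hG.not_adj_root ⟨v, hv⟩ ((arr_digraphInput_pos_iff G ⟨v, hv⟩ r).1 e)

theorem Solved.cost_eq (h : Solved n a b ((digraphInput G).arr aMain) s) (hG : G.IsRooted r d)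
    (hb : 0 < b) (hbn : b ≤ n) (hab : a ≤ b) :
    s.reg rCost = minCost a b (rowAt (s.arr aCost) (r * n)) 0 := by
  rw [h.cost, sum_range]
  exact sum_pay_eq (h.isCostTable hbn) h.isLevelFunction hG (h.level_root hG) hb hab

theorem length_fires (n a b : ℕ) (T F : ℕ → ℕ) (c : ℕ) :
    (fires n a b T F c n).length = #{v ∈ range n | payAt n a b T F v = c} := by
  rw [fires, ← List.toFinset_card_of_nodup (List.nodup_range.filter _), List.toFinset_filter,
    List.toFinset_range]
  simp

/-- Every cost is that of a large fire, that of a small fire, or zero. -/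
theorem sum_payAt (n a b : ℕ) (T F : ℕ → ℕ) :
    ∑ v ∈ range n, payAt n a b T F v =
      3 * (fires n a b T F 3 n).length + 2 * (fires n a b T F 2 n).length := by
  rw [length_fires, length_fires, card_filter, card_filter, mul_sum, mul_sum, ← sum_add_distrib]
  refine sum_congr rfl fun v _ => ?_
  unfold payAt pay
  split_ifs <;> simp_all

/-- The output of the algorithm has at most `11 / 6` times the optimal length: at the number `b` of
rounds that is found, which is at most the burning number, the `x` large and `y` small fires of a
cheapest solution satisfy `3 * x + 2 * y + b / 2 ≤ 3 * b`. Hence in a list of length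
`11 / 6 * b` that begins with them, each is lit early enough to reach its radius. Each loop is
repeated at most `2 * n` times: the last one, which fills up the output, at most `11 / 6 * b` times,
and the others at most `n` times. -/
theorem halts_burnProg (hG : G.IsRooted r d) :
    Halts (2 * n) burnProg (digraphInput G) fun s => ∃ l : List (Fin n),
      s.HasOutput l ∧ G.IsBurningSequence l ∧ 6 * l.length ≤ 11 * G.burningNumber := by
  have : Nonempty (Fin n) := ⟨r⟩
  have hN : G.burningNumber ≤ n := by simpa using G.burningNumber_le_card
  have hsearch := halts_searchProg (m := 2 * n) (n := n) (N := G.burningNumber)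
    (s := digraphInput G) rfl rfl rfl (by omega) G.burningNumber_pos hN
    (isForest_digraphInput hG) (fun v => by simp [digraphInput]) fun s hs => by
      obtain ⟨l, hl, hburn⟩ := G.exists_isBurningSequence_length_eq_burningNumber
      rw [hs.cost_eq hG G.burningNumber_pos hN (by omega)]
      exact minCost_root_add_le (hs.isCostTable hN) hG (by omega) hl hburn
  refine .seq (hsearch.frame.mono ?_)
  rintro s1 ⟨hf, b, h⟩
  have hs := h.solved
  have hbn := h.le.trans hN
  have hcost := hs.cost
  have hle := h.cost_le
  rw [sum_payAt] at hcost
  have hpos : s1.reg rPos = 0 := by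
    rw [hf.1 _ (by decide)]
    rfl
  refine (halts_outputProg h.size h.small h.big hpos le_rfl hbn (by omega)).mono ?_
  rintro s2 ⟨L, hL, ⟨c, hLc⟩, hL1, hL2⟩
  have hLlt (v : ℕ) (hv : v ∈ L) : v < n := by
    rw [hLc] at hv
    simp only [fires, List.mem_append, List.mem_filter, List.mem_range, List.mem_replicate] at hv
    have := r.pos
    omega
  have hmap : (L.map fun v => if h : v < n then (⟨v, h⟩ : Fin n) else r).length = L.length :=
    List.length_map _
  refine ⟨L.map fun v => if h : v < n then ⟨v, h⟩ else r, ⟨by rw [hL.1, hmap], fun i => ?_⟩, ?_,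
    by rw [hmap]; have := h.le; omega⟩
  · have hi : (i : ℕ) < L.length := hmap ▸ i.2
    rw [hL.2 i hi]
    simp [hLlt _ (List.getElem_mem hi)]
  · refine isBurningSequence_of_forall_pay hs.isLevelFunction hG (hs.level_root hG)
      fun v hv => ?_
    have hmem {c' : ℕ} (hv' : payAt n (b / 2) b (s1.arr aCost) (s1.arr aLevel) v = c') :
        (v : ℕ) ∈ fires n (b / 2) b (s1.arr aCost) (s1.arr aLevel) c' n := by
      simp [fires, hv']
    have hget {i : ℕ} (hi : L[i]? = some (v : ℕ)) :
        (L.map fun v => if h : v < n then (⟨v, h⟩ : Fin n) else r)[i]? = some v := by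
      simp [hi]
    rw [hmap]
    have hp : ¬ Passive (b / 2) b (rowAt (s1.arr aCost) (v * n)) (s1.arr aLevel v) := fun hp =>
      hv (if_pos hp)
    by_cases hlarge :
        rowAt (s1.arr aCost) (v * n) (b - 1) < rowAt (s1.arr aCost) (v * n) (b / 2 - 1)
    · -- The large fires are lit first.
      obtain ⟨i, hi, hiv⟩ := List.getElem_of_mem (hmem (c' := 3) (by
        rw [payAt, pay, if_neg hp, if_pos hlarge]))
      refine ⟨i, hget ?_, ?_⟩
      · rw [hLc, List.getElem?_append_left hi, List.getElem?_eq_getElem hi, hiv]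
      · rw [out, if_neg hp, if_pos hlarge]
        have := h.pos
        omega
    · -- The small fires are lit right after the large ones.
      obtain ⟨i, hi, hiv⟩ := List.getElem_of_mem (hmem (c' := 2) (by
        rw [payAt, pay, if_neg hp, if_neg hlarge]))
      refine ⟨(fires n (b / 2) b (s1.arr aCost) (s1.arr aLevel) 3 n).length + i, hget ?_, ?_⟩
      · rw [hLc, List.getElem?_append_right (Nat.le_add_right _ _), Nat.add_sub_cancel_left,
          List.getElem?_append_left hi, List.getElem?_eq_getElem hi, hiv]
      · rw [out, if_neg hp, if_neg hlarge]
        have := h.pos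
        omega

end RAM

theorem mainTheorem4 :
    ∃ (p : RAM.Prog) (q : Polynomial ℕ),
      ∀ (n : ℕ) (G : Digraph (Fin n)), G.IsArborescence →
        ∃ (t : ℕ) (s : RAM.State) (l : List (Fin n)),
          RAM.Run p (RAM.digraphInput G) t s ∧ t ≤ q.eval n ∧ s.HasOutput l ∧
          G.IsBurningSequence l ∧ (l.length : ℝ) ≤ 1.905 * (G.burningNumber : ℝ) := by
  obtain ⟨q, hq⟩ := RAM.burnProg.exists_polynomial_timeBound
  refine ⟨RAM.burnProg, q.comp (2 * .X), fun n G hG => ?_⟩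
  obtain ⟨r, d, hG⟩ := hG.exists_isRooted
  obtain ⟨t, s, h1, h2, l, h3, h4, h5⟩ := RAM.halts_burnProg hG
  refine ⟨t, s, l, h1, ?_, h3, h4, ?_⟩
  · rw [hq] at h2
    simpa using h2
  · have h6 : (6 * l.length : ℝ) ≤ 11 * G.burningNumber := by exact_mod_cast h5
    have h7 : (0 : ℝ) ≤ G.burningNumber := Nat.cast_nonneg _
    linarith
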